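/- Let $I=[0,1]$ and let $\mathrm{Homeo}_+(I)$ be the group of increasing homeomorphisms of $I$, with product $(fg)(t)=f(g(t))$. **Marked functions.** The support of $f$ is $\{t : f(t)\neq t\}$; its components are the *orbitals* of $f$, their endpoints are the *transition points* of $f$, and the *extended support* of $f$ is the interior (in $\mathbb R$) of the closure of the support. An orbital (and the bump of $f$ on it) is positive if $f(t)>t$ on it and negative if $f(t)<t$ on it. A *marked function* is an $f\in\mathrm{Homeo}_+(I)$ with a chosen point (marker) $s$ in each orbital $(u,v)$; the *feet* of this bump are $(u,s)$ and $[s',v)$, where $s'=f(s)$ if the bump is positive and $s'=f^{-1}(s)$ if it is negative. A set of marked functions is *fast* if the feet of any two different bumps (indexed by function and orbital) are disjoint. **Standard generating sets.** A marked function $f$ with finitely many bumps is *standard* if its extended support is a nonempty interval, each positive bump is to the right of each negative bump, and $n\le p\le n+1$, where $p$, $n$ are the numbers of positive and negative bumps. For standard $f,g$ write $f\ll g$ if the extended supports are disjoint and that of $f$ is to the left of that of $g$; $f\sqsubset g$ if the closure of the extended support of $f$ is contained in the extended support of $g$; and $f<g$ if $f\ll g$ or $f\sqsubset g$. If $f$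 has more than two orbitals, $f^\circ$ is $f$ with its leftmost and rightmost bumps replaced by the identity and the other markers kept; otherwise $f^\circ$ is any positive bump, with any marker, supported on the left foot of the positive orbital of $f$. The pair $(f,g)$ is *standard* (recursively) if $\{f,g\}$ is fast and either $f\ll g$, or $f\sqsubset g$ and $(g^\circ,f)$ is standard. A *standard generating set* is a finite set $A$ of standard functions such that for any two distinct $f,g\in A$ one of $(f,g)$, $(g,f)$ is standard; it is linearly ordered by $<$. For $f<g$ let the *oscillation* $o(f,g)$ be the number of orbitals of $g$ that contain a transition point of $f$. Write $A=B*C$ if $A=B\cup C$ and $b<c$, $o(b,c)=1$ for all $b\in B$, $c\in C$. Let $\langle A\rangle$ be the subgroup of $\mathrm{Homeo}_+(I)$ generated by $A$. **Actions.** Let a group $H$ of homeomorphisms act on the set $\{hK : h\in H\}$ of translates of some $K\subseteq I$. The action is *faithful* if only the identity of $H$ fixes every translate, and *consistent* if every $h\in H$ with $hK\cap K\neq\emptyset$ fixes $K$ pointwise. If $G$ acts on $\mathcal X$ and $H$ acts on $\mathcal Y$, the *permutation wreath product* $G\wr H$ is the semidirect product $\big(\bigoplus_{\mathcal Y}G\big)\rtimes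 H$, where $(h\varphi)(y)=\varphi(h^{-1}y)$, acting on $\mathcal X\times\mathcal Y$ by $(\varphi,h)(x,y)=(\varphi(hy)\,x,\;hy)$. **Proposition.** Let $A$ be a standard generating set with $o(f,g)>0$ for all $f<g$ in $A$, and let $A=B*C$ with $B,C$ nonempty. Then there are an open interval $J\subset I$ that contains the supports of all elements of $B$, is contained in the rightmost orbital of each element of $C$ and is disjoint from the feet of $C$, and a point $t_0$ in the rightmost orbital of each element of $B$. For every such $J$ and $t_0$, put $$\mathcal X=\{g(t_0) : g\in\langle B\rangle\},\qquad \mathcal Y=\{hJ : h\in\langle C\rangle\}.$$ Then the action of $\langle B\rangle$ on $\mathcal X$ (the translates of $\{t_0\}$) and the action of $\langle C\rangle$ on $\mathcal Y$ are faithful and consistent. Moreover $(x,hJ)\mapsto h(x)$, for $x\in\mathcal X$ and $h\in\langle C\rangle$, is a well-defined bijection $\Psi$ from $\mathcal X\times\mathcal Y$ onto the orbit of $t_0$ under $\langle A\rangle$, and there is a group isomorphism $\Phi:\langle B\rangle\wr\langle C\rangle\to\langle A\rangle$ with $\Psi(w\cdot z)=\Phi(w)\,\Psi(z)$ for all $w\in\langle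 B\rangle\wr\langle C\rangle$ and $z\in\mathcal X\times\mathcal Y$. That is, the action of $\langle A\rangle$ on $\mathcal X\times\mathcal Y$ is the permutation wreath product of the two actions, and $\langle B*C\rangle\cong\langle B\rangle\wr\langle C\rangle$. -/

import Mathlib

open Set
open scoped Pointwise unitInterval

namespace OscGroups

/-! Throughout, `Homeo₊(I)` is the group `I ≃o I` of increasing bijections of the unit interval
(these are exactly its orientation preserving homeomorphisms). It acts on the left, `f • t = f t`
and `(f * g) • t = f (g t)`, where one may also write it on the right. -/

/-- The support of a homeomorphism of `I`. -/
def supp (f : I ≃o I) : Set I := {t | f t ≠ t}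

/-- The extended support: the interior (in `ℝ`) of the closure of the support. -/
def extSupp (f : I ≃o I) : Set ℝ := interior (closure ((↑) '' supp f))

/-- The orbitals of `f`, i.e. the connected components of its support. The component `(u, v)`
is given by the pair `(u, v)` of its endpoints: `u` and `v` are fixed and nothing between is. -/
def orbitals (f : I ≃o I) : Set (I × I) :=
  {p | p.1 < p.2 ∧ f p.1 = p.1 ∧ f p.2 = p.2 ∧ Ioo p.1 p.2 ⊆ supp f}

/-- The orbitals on which the bump of `f` is positive. -/
def posOrbitals (f : I ≃o I) : Set (I × I) :=
  {p | p ∈ orbitals f ∧ ∀ t ∈ Ioo p.1 p.2, t < f t}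

/-- The orbitals on which the bump of `f` is negative. -/
def negOrbitals (f : I ≃o I) : Set (I × I) :=
  {p | p ∈ orbitals f ∧ ∀ t ∈ Ioo p.1 p.2, f t < t}

/-- The transition points: the endpoints of the orbitals. -/
def transitionPoints (f : I ≃o I) : Set I :=
  {t | ∃ p ∈ orbitals f, t = p.1 ∨ t = p.2}

/-- `p` is the rightmost (maximum) orbital of `f`. -/
def IsRightmost (f : I ≃o I) (p : I × I) : Prop :=
  p ∈ orbitals f ∧ ∀ q ∈ orbitals f, q.2 ≤ p.2

/-- `p` is the leftmost (minimum) orbital of `f`. -/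
def IsLeftmost (f : I ≃o I) (p : I × I) : Prop :=
  p ∈ orbitals f ∧ ∀ q ∈ orbitals f, p.1 ≤ q.1

/-- A marked function: a homeomorphism with a point chosen in each of its orbitals. -/
structure MarkedFunction where
  toHomeo : I ≃o I
  marker : orbitals toHomeo → I
  marker_mem : ∀ p : orbitals toHomeo, marker p ∈ Ioo p.1.1 p.1.2

namespace MarkedFunction

/-- The point `t_a` of the bump `a` of `f` on `p` with marker `s_a`: the image of `s_a` under `a`
if `a` is positive and under `a⁻¹` if `a` is negative. -/
noncomputable def endMarker (f : MarkedFunction) (p : orbitals f.toHomeo) : I :=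
  if f.marker p < f.toHomeo (f.marker p) then f.toHomeo (f.marker p)
  else f.toHomeo.symm (f.marker p)

/-- The union of the two feet `(u, s)` and `[t, v)` of the bump of `f` on the orbital `(u, v)`. -/
def bumpFeet (f : MarkedFunction) (p : orbitals f.toHomeo) : Set I :=
  Ioo p.1.1 (f.marker p) ∪ Ico (f.endMarker p) p.1.2

/-- The union of all feet of `f`. -/
def feet (f : MarkedFunction) : Set I := ⋃ p, f.bumpFeet p

/-- `S` is geometrically fast: the feet of any two different bumps of `S` are disjoint. Bumps are
indexed by the function and the orbital, so no bump can occur in two elements of `S`. -/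
def IsFast (S : Set MarkedFunction) : Prop :=
  ∀ f ∈ S, ∀ g ∈ S, ∀ (p : orbitals f.toHomeo) (q : orbitals g.toHomeo),
    ¬ (f = g ∧ p.1 = q.1) → Disjoint (f.bumpFeet p) (g.bumpFeet q)

/-- Standard functions. -/
structure IsStandard (f : MarkedFunction) : Prop where
  finite_orbitals : (orbitals f.toHomeo).Finite
  extSupp_nonempty : (extSupp f.toHomeo).Nonempty
  extSupp_interval : (extSupp f.toHomeo).OrdConnected
  neg_left_of_pos : ∀ p ∈ negOrbitals f.toHomeo, ∀ q ∈ posOrbitals f.toHomeo, p.2 ≤ q.1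
  neg_le_pos : (negOrbitals f.toHomeo).ncard ≤ (posOrbitals f.toHomeo).ncard
  pos_le_neg : (posOrbitals f.toHomeo).ncard ≤ (negOrbitals f.toHomeo).ncard + 1

/-- `f ≪ g`: the extended supports are disjoint, that of `f` being to the left of that of `g`. -/
def LL (f g : MarkedFunction) : Prop :=
  ∀ x ∈ extSupp f.toHomeo, ∀ y ∈ extSupp g.toHomeo, x < y

/-- `f ⊏ g`: the closure of the extended support of `f` is in the extended support of `g`. -/
def SqSubset (f g : MarkedFunction) : Prop :=
  closure (extSupp f.toHomeo) ⊆ extSupp g.toHomeo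

/-- `f < g`: either `f ≪ g` or `f ⊏ g`. -/
def Lt (f g : MarkedFunction) : Prop := LL f g ∨ SqSubset f g

/-- `f'` is obtained from `f` by keeping all bumps (with their markers) but the two outermost
ones. -/
def IsTrimmed (f f' : MarkedFunction) : Prop :=
  (∀ p ∈ orbitals f.toHomeo, ∀ t ∈ Ioo p.1 p.2,
    (¬ IsLeftmost f.toHomeo p ∧ ¬ IsRightmost f.toHomeo p → f'.toHomeo t = f.toHomeo t) ∧
    (IsLeftmost f.toHomeo p ∨ IsRightmost f.toHomeo p → f'.toHomeo t = t)) ∧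
  (∀ t, t ∉ supp f.toHomeo → f'.toHomeo t = t) ∧
  ∀ (p : I × I) (hp : p ∈ orbitals f.toHomeo) (hp' : p ∈ orbitals f'.toHomeo),
    f'.marker ⟨p, hp'⟩ = f.marker ⟨p, hp⟩

/-- `f'` is a positive bump (with an arbitrary marker) whose support is the left foot of a
positive orbital of `f`. -/
def IsFootBump (f f' : MarkedFunction) : Prop :=
  ∃ p : orbitals f.toHomeo, p.1 ∈ posOrbitals f.toHomeo ∧
    orbitals f'.toHomeo = {(p.1.1, f.marker p)} ∧
    posOrbitals f'.toHomeo = {(p.1.1, f.marker p)}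

/-- `f'` is a possible choice of the reduction `f°` of the standard function `f`. -/
def IsReduction (f f' : MarkedFunction) : Prop :=
  (2 < (orbitals f.toHomeo).ncard ∧ IsTrimmed f f') ∨
  ((orbitals f.toHomeo).ncard ≤ 2 ∧ IsFootBump f f')

/-- Standard pairs, recursively: `{f, g}` is fast, and `f ≪ g`, or else `f ⊏ g` and `(g°, f)` is a
standard pair. -/
inductive StandardPair : MarkedFunction → MarkedFunction → Prop
  | of_ll {f g : MarkedFunction} (hf : f.IsStandard) (hg : g.IsStandard) (hfast : IsFast {f, g})
      (h : LL f g) : StandardPair f g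
  | of_sqSubset {f g : MarkedFunction} (g' : MarkedFunction) (hf : f.IsStandard)
      (hg : g.IsStandard) (hfast : IsFast {f, g}) (h : SqSubset f g) (hg' : IsReduction g g')
      (hpair : StandardPair g' f) : StandardPair f g

/-- The oscillation `o(f, g)` of a pair `f < g`: the number of orbitals of `g` that contain a
transition point of `f`. -/
noncomputable def osc (f g : MarkedFunction) : ℕ :=
  {p ∈ orbitals g.toHomeo | ∃ t ∈ transitionPoints f.toHomeo, t ∈ Ioo p.1 p.2}.ncard

/-- Standard generating sets: finite, pairwise standard sets of standard functions. -/
structure IsStandardGeneratingSet (A : Set MarkedFunction) : Prop where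
  finite : A.Finite
  isStandard : ∀ f ∈ A, f.IsStandard
  standardPair : ∀ f ∈ A, ∀ g ∈ A, f ≠ g → StandardPair f g ∨ StandardPair g f

/-- `A = B * C`. -/
structure IsStar (A B C : Set MarkedFunction) : Prop where
  eq_union : A = B ∪ C
  lt : ∀ b ∈ B, ∀ c ∈ C, Lt b c
  osc_eq_one : ∀ b ∈ B, ∀ c ∈ C, osc b c = 1

/-- The group `⟨A⟩` of homeomorphisms generated by a set of marked functions. -/
def gen (A : Set MarkedFunction) : Subgroup (I ≃o I) := Subgroup.closure (toHomeo '' A)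

/-- `J` is an open interval that contains the supports of all elements of `B`, is contained in the
rightmost orbital of each element of `C` and is disjoint from the feet of `C`. -/
structure IsSeparatingInterval (B C : Set MarkedFunction) (J : Set I) : Prop where
  isInterval : ∃ a b : I, J = Ioo a b
  supp_subset : ∀ b ∈ B, supp b.toHomeo ⊆ J
  subset_rightmost : ∀ c ∈ C, ∀ p, IsRightmost c.toHomeo p → J ⊆ Ioo p.1 p.2
  disjoint_feet : ∀ c ∈ C, Disjoint J c.feet

/-- `t` is in the rightmost orbital of each element of `B`. -/
def InRightmostOrbitals (B : Set MarkedFunction) (t : I) : Prop :=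
  ∀ b ∈ B, ∀ p, IsRightmost b.toHomeo p → t ∈ Ioo p.1 p.2

end MarkedFunction

/-- The action of a group `H` of homeomorphisms on the translates of `K` is consistent: if
`h • K` meets `K`, then `h` fixes `K` pointwise. -/
def IsConsistent (H : Subgroup (I ≃o I)) (K : Set I) : Prop :=
  ∀ h ∈ H, ((h • K) ∩ K).Nonempty → ∀ t ∈ K, h t = t

section Wreath

variable (G H Y : Type*) [Group G] [Group H] [MulAction H Y]

/-- The direct sum `∑_Y G`: the finitely supported elements of `G^Y`. -/
def directSum : Subgroup (Y → G) where
  carrier := {φ | (Function.mulSupport φ).Finite}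
  one_mem' := by simp
  mul_mem' {φ ψ} hφ hψ := (hφ.union hψ).subset (Function.mulSupport_mul φ ψ)
  inv_mem' {φ} hφ := by simpa using hφ

/-- The action of `H` on `∑_Y G` by `(h φ)(y) = φ(h⁻¹ y)`. -/
def shift : H →* MulAut (directSum G Y) where
  toFun h :=
    { toFun := fun φ => ⟨fun y => φ.1 (h⁻¹ • y), by
        refine (φ.2.image (fun y => h • y)).subset ?_
        intro y hy
        exact ⟨h⁻¹ • y, hy, smul_inv_smul h y⟩⟩
      invFun := fun φ => ⟨fun y => φ.1 (h • y), by
        refine (φ.2.image (fun y => h⁻¹ • y)).subset ?_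
        intro y hy
        exact ⟨h • y, hy, inv_smul_smul h y⟩⟩
      left_inv := fun φ => by ext y; simp
      right_inv := fun φ => by ext y; simp
      map_mul' := fun φ ψ => rfl }
  map_one' := by ext φ y; simp
  map_mul' h k := by ext φ y; simp [mul_smul]

/-- The permutation wreath product `G ≀ H` over the `H`-set `Y`: the semidirect product
`∑_Y G ⋊ H`. -/
abbrev PermWreath : Type _ := directSum G Y ⋊[shift G H Y] H

/-- The action of `G ≀ H` on `X × Y`: `(φ, h) (x, y) = (φ(h y) x, h y)`. -/
instance permWreathAction (X : Type*) [MulAction G X] : MulAction (PermWreath G H Y) (X × Y) where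
  smul w p := (w.left.1 (w.right • p.2) • p.1, w.right • p.2)
  one_smul p := by
    change ((1 : directSum G Y).1 ((1 : H) • p.2) • p.1, (1 : H) • p.2) = p
    simp
  mul_smul v w p := by
    change (((v * w).left).1 ((v * w).right • p.2) • p.1, (v * w).right • p.2) =
      (v.left.1 (v.right • w.right • p.2) • w.left.1 (w.right • p.2) • p.1,
        v.right • w.right • p.2)
    simp [shift, mul_smul]

end Wreath

end OscGroups

/-! The proof has an abstract half and a dynamical half.

Abstract half (`WreathPair.exists_equiv`): let `G` be supported in an interval `J`, and let `H` act
consistently and faithfully on the translates of `J`. By consistency, translates that meet coincide,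
and the conjugate of `G` that lives on `hJ` is transported there in a way that depends only on `hJ`.
Finitely many such conjugates act independently on disjoint intervals, `H` permutes them, and
faithfulness leaves no relation besides those of `G ≀ H`. It remains to produce `J` and `t₀` and to
check consistency and faithfulness for `⟨B⟩` and `⟨C⟩`.

Consistency is ping-pong (`PingPong.consistent`): on an interval that misses all feet, every element
acts as a reduced word, and a nonempty reduced word pushes the interval into a foot.

Faithfulness follows from `IsStandardGeneratingSet.eq_one_of_fixes`: an element `h` that fixes
pointwise an invariant set `X` meeting all rightmost orbitals is trivial. Otherwise `h` fixes the
left end of one of its orbitals but is nontrivial immediately to the right of it. So it suffices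
that all points are rigid (`PingPong.rigid_of_anchors`). A point that is not rigid lies in a foot,
and so do its successive preimages under the letters of these feet; hence it has arbitrarily long
ping-pong histories. A history as long as a word for `h` cannot be used up by `h`, and reduced words
are determined by their values on `X`, so `h` returns the same history and is the identity there.

The history has to start in an orbital that meets `X`. The recursive definition of standard pairs
implies (`StandardPair.linked`) that each orbital containing a transition point of another generator
is joined by a chain of overlapping orbitals to a rightmost one, and therefore meets `X`. An orbital
that misses `X` is thus free of feet of other generators; there an element with a fixed point acts
as a power of a single generator (`PingPong.eq_zpow_of_fixed`), and rigidity can be read off from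
the next orbital that does meet `X`.

Finally, oscillation `1` forces each `b ∈ B` between the feet of the rightmost bump of each `c ∈ C`
(`StandardPair.between_feet`), which gives `J`. -/

namespace OscGroups

/-! ### Powers of order isomorphisms -/

section OrderIsoLemmas

variable {α : Type*} [LinearOrder α]

lemma orderIso_inv_apply_self (f : α ≃o α) (t : α) : f⁻¹ (f t) = t := f.symm_apply_apply t

lemma orderIso_apply_inv_self (f : α ≃o α) (t : α) : f (f⁻¹ t) = t := f.apply_symm_apply t

lemma ordConnected_image_orderIso (f : α ≃o α) {K : Set α} (hK : K.OrdConnected) :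
    (f '' K).OrdConnected := by
  rw [OrderIso.image_eq_preimage_symm]
  exact hK.preimage_mono f.symm.monotone

lemma pow_apply_eq_self {f : α ≃o α} {t : α} (h : f t = t) (n : ℕ) : (f ^ n) t = t := by
  induction n with
  | zero => rfl
  | succ n ih => rw [pow_succ, RelIso.mul_apply, h, ih]

lemma zpow_apply_eq_self {f : α ≃o α} {t : α} (h : f t = t) (k : ℤ) : (f ^ k) t = t := by
  cases k with
  | ofNat n => simpa using pow_apply_eq_self h n
  | negSucc n =>
    rw [zpow_negSucc]
    conv_lhs => rw [← pow_apply_eq_self h (n + 1)]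
    exact orderIso_inv_apply_self _ _

lemma lt_pow_apply {f : α ≃o α} {t : α} (h : t < f t) (n : ℕ) : t < (f ^ (n + 1)) t := by
  induction n with
  | zero => simpa using h
  | succ n ih =>
    rw [pow_succ', RelIso.mul_apply]
    exact h.trans (f.lt_iff_lt.2 ih)

lemma pow_apply_lt {f : α ≃o α} {t : α} (h : f t < t) (n : ℕ) : (f ^ (n + 1)) t < t := by
  induction n with
  | zero => simpa using h
  | succ n ih =>
    rw [pow_succ', RelIso.mul_apply]
    exact (f.lt_iff_lt.2 ih).trans h

lemma pow_apply_ne {f : α ≃o α} {t : α} (h : f t ≠ t) {n : ℕ} (hn : n ≠ 0) :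
    (f ^ n) t ≠ t := by
  obtain ⟨m, rfl⟩ := Nat.exists_eq_succ_of_ne_zero hn
  rcases lt_or_gt_of_ne h with h | h
  · exact (pow_apply_lt h m).ne
  · exact (lt_pow_apply h m).ne'

lemma zpow_apply_ne {f : α ≃o α} {t : α} (h : f t ≠ t) {k : ℤ} (hk : k ≠ 0) :
    (f ^ k) t ≠ t := by
  cases k with
  | ofNat n => simpa using pow_apply_ne h (n := n) (by simpa using hk)
  | negSucc n =>
    rw [zpow_negSucc]
    intro e
    apply pow_apply_ne h (n := n + 1) (by omega)
    conv_lhs => rw [← e]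
    exact orderIso_apply_inv_self _ _

end OrderIsoLemmas

/-! ### Ping-pong systems and reduced words -/

/-- The combinatorial data of a set of homeomorphisms whose feet are disjoint: letters acting on a
linear order, the set of points that a letter moves (closed on the left), and the feet into which a
letter pushes the points that it moves. -/
structure PingPong (ι α : Type*) [LinearOrder α] where
  act : ι → α ≃o α
  inv : ι → ι
  moved : ι → Set α
  foot : ι → Set α
  inv_inv : ∀ a, inv (inv a) = a
  act_inv : ∀ a, act (inv a) = (act a)⁻¹
  foot_disjoint : ∀ a b, a ≠ b → Disjoint (foot a) (foot b)
  foot_subset : ∀ a, foot a ⊆ moved a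
  fix : ∀ a, ∀ x ∉ moved a, act a x = x
  maps : ∀ a, ∀ x ∈ moved a, x ∉ foot (inv a) → act a x ∈ foot a
  back : ∀ a, ∀ x ∈ foot a, act (inv a) x ∈ moved a ∧ act (inv a) x ∉ foot (inv a)
  dichotomy : ∀ a, ∀ K : Set α, K.OrdConnected → Disjoint K (foot a) → Disjoint K (foot (inv a)) →
    K ⊆ moved a ∨ Disjoint K (moved a)

namespace PingPong

variable {ι α : Type*} [LinearOrder α] (P : PingPong ι α)

/-- The group generated by the letters. -/
def group : Subgroup (α ≃o α) := Subgroup.closure (range P.act)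

/-- The homeomorphism given by a word; its last letter acts first. -/
def val (w : List ι) : α ≃o α := (w.map P.act).prod

@[simp] lemma val_nil : P.val [] = 1 := rfl

@[simp] lemma val_cons (a : ι) (w : List ι) : P.val (a :: w) = P.act a * P.val w := by
  simp [val]

lemma val_append (v w : List ι) : P.val (v ++ w) = P.val v * P.val w := by
  simp [val]

lemma act_mem (a : ι) : P.act a ∈ P.group := Subgroup.subset_closure ⟨a, rfl⟩

lemma val_mem (w : List ι) : P.val w ∈ P.group := by
  induction w with
  | nil => exact one_mem _
  | cons a w ih =>
    rw [val_cons]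
    exact mul_mem (P.act_mem a) ih

lemma exists_val_inv (w : List ι) : ∃ v, P.val v = (P.val w)⁻¹ := by
  induction w with
  | nil => exact ⟨[], by simp⟩
  | cons a w ih =>
    obtain ⟨v, hv⟩ := ih
    exact ⟨v ++ [P.inv a], by simp [val_append, hv, P.act_inv]⟩

lemma exists_val_eq {h : α ≃o α} (hh : h ∈ P.group) : ∃ w, P.val w = h := by
  induction hh using Subgroup.closure_induction with
  | mem x hx =>
    obtain ⟨a, rfl⟩ := hx
    exact ⟨[a], by simp⟩
  | one => exact ⟨[], rfl⟩
  | mul x y _ _ hx hy =>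
    obtain ⟨v, rfl⟩ := hx
    obtain ⟨w, rfl⟩ := hy
    exact ⟨v ++ w, P.val_append v w⟩
  | inv x _ hx =>
    obtain ⟨w, rfl⟩ := hx
    exact P.exists_val_inv w

lemma act_act_inv (a : ι) (x : α) : P.act a (P.act (P.inv a) x) = x := by
  rw [P.act_inv]
  exact orderIso_apply_inv_self _ _

lemma act_inv_act (a : ι) (x : α) : P.act (P.inv a) (P.act a x) = x := by
  rw [P.act_inv]
  exact orderIso_inv_apply_self _ _

lemma foot_eq {a b : ι} {x : α} (ha : x ∈ P.foot a) (hb : x ∈ P.foot b) : a = b := by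
  by_contra hab
  exact Set.disjoint_left.1 (P.foot_disjoint a b hab) ha hb

/-- A word is reduced on `E` if each of its letters moves the image of `E` under the letters before
it, and that image is disjoint from the source foot of the letter. -/
def Reduced (E : Set α) : List ι → Prop
  | [] => True
  | a :: u => Reduced E u ∧ ∀ x ∈ E, P.val u x ∈ P.moved a ∧ P.val u x ∉ P.foot (P.inv a)

lemma Reduced.mem_foot {P : PingPong ι α} {E : Set α} {a : ι} {u : List ι}
    (h : P.Reduced E (a :: u)) {x : α} (hx : x ∈ E) : P.val (a :: u) x ∈ P.foot a := by
  rw [val_cons]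
  exact P.maps a _ (h.2 x hx).1 (h.2 x hx).2

/-- An interval that misses both feet of `b` lies on one side of `dichotomy`. If it lies in the foot
of a letter other than `b⁻¹`, then either that letter is `b`, whose foot is moved by `b`, or
disjointness of feet leads back to the first case. -/
lemma subset_moved_or {K : Set α} (hK : K.OrdConnected) {b : ι}
    (h : (Disjoint K (P.foot b) ∧ Disjoint K (P.foot (P.inv b))) ∨
      ∃ a, K ⊆ P.foot a ∧ a ≠ P.inv b) :
    (∀ x ∈ K, x ∈ P.moved b ∧ x ∉ P.foot (P.inv b)) ∨ ∀ x ∈ K, x ∉ P.moved b := by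
  have key : Disjoint K (P.foot b) → Disjoint K (P.foot (P.inv b)) →
      (∀ x ∈ K, x ∈ P.moved b ∧ x ∉ P.foot (P.inv b)) ∨ ∀ x ∈ K, x ∉ P.moved b := by
    intro h1 h2
    rcases P.dichotomy b K hK h1 h2 with h | h
    · exact Or.inl fun x hx => ⟨h hx, Set.disjoint_left.1 h2 hx⟩
    · exact Or.inr fun x hx => Set.disjoint_left.1 h hx
  rcases h with ⟨h1, h2⟩ | ⟨a, ha, hab⟩
  · exact key h1 h2
  · have h2 : Disjoint K (P.foot (P.inv b)) := (P.foot_disjoint a _ hab).mono_left ha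
    by_cases e : a = b
    · subst e
      exact Or.inl fun x hx => ⟨P.foot_subset a (ha hx), Set.disjoint_left.1 h2 hx⟩
    · exact key ((P.foot_disjoint a b e).mono_left ha) h2

/-- The letter `b` cancels against the head of `u`, or extends `u`, or fixes the image of `E`
pointwise and is dropped; so the length falls by at most one. For empty `u` nothing locates `E`
relative to the feet, hence the side condition. -/
lemma exists_reduced_act {E : Set α} (hE : E.OrdConnected) {u : List ι} (hu : P.Reduced E u)
    (b : ι) (h : u ≠ [] ∨ (Disjoint E (P.foot b) ∧ Disjoint E (P.foot (P.inv b)))) :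
    ∃ v, P.Reduced E v ∧ (∀ x ∈ E, P.act b (P.val u x) = P.val v x) ∧ u.length ≤ v.length + 1 := by
  have key : (∀ x ∈ P.val u '' E, x ∈ P.moved b ∧ x ∉ P.foot (P.inv b)) ∨
      (∀ x ∈ P.val u '' E, x ∉ P.moved b) → ∃ v, P.Reduced E v ∧
        (∀ x ∈ E, P.act b (P.val u x) = P.val v x) ∧ u.length ≤ v.length + 1 := by
    rintro (h | h)
    · refine ⟨b :: u, ⟨hu, fun x hx => h _ (mem_image_of_mem _ hx)⟩, fun x _ => ?_, ?_⟩
      · simp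
      · simp only [List.length_cons]; omega
    · exact ⟨u, hu, fun x hx => P.fix b _ (h _ (mem_image_of_mem _ hx)), by omega⟩
  have hc := ordConnected_image_orderIso (P.val u) hE
  cases u with
  | nil =>
    refine key (P.subset_moved_or hc (Or.inl ?_))
    simpa using h
  | cons a u =>
    by_cases e : a = P.inv b
    · subst e
      refine ⟨u, hu.1, fun x hx => ?_, by simp⟩
      rw [val_cons, RelIso.mul_apply, P.act_act_inv]
    · refine key (P.subset_moved_or hc (Or.inr ⟨a, ?_, e⟩))
      rintro _ ⟨x, hx, rfl⟩
      exact hu.mem_foot hx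

/-- Each letter of `w` uses up at most one letter of `u`. If `w` is no longer than `u`, the reduced
word is still nonempty whenever another letter arrives, so the position of `E` itself never matters.
-/
lemma exists_reduced {E : Set α} (hE : E.OrdConnected) {u : List ι} (hu : P.Reduced E u)
    (w : List ι) (h : w.length ≤ u.length ∨ ∀ a, Disjoint E (P.foot a)) :
    ∃ v, P.Reduced E v ∧ (∀ x ∈ E, P.val w (P.val u x) = P.val v x) ∧
      u.length ≤ v.length + w.length := by
  induction w with
  | nil => exact ⟨u, hu, fun x _ => rfl, by simp⟩
  | cons b w ih =>
    obtain ⟨v, hv, hv', hl⟩ := ih (h.imp_left fun h => by simp at h; omega)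
    obtain ⟨v', h1, h2, h3⟩ := P.exists_reduced_act hE hv b (by
      rcases h with h | h
      · left
        rintro rfl
        simp at h hl
        omega
      · exact Or.inr ⟨h _, h _⟩)
    refine ⟨v', h1, fun x hx => ?_, by simp; omega⟩
    rw [val_cons, RelIso.mul_apply, hv' x hx, h2 x hx]

/-- If a set is disjoint from all feet, then an element of the group that does not move it off
itself fixes it pointwise. -/
theorem consistent {J : Set α} (hJ : J.OrdConnected) (hJf : ∀ a, Disjoint J (P.foot a))
    {h : α ≃o α} (hh : h ∈ P.group) (hne : (h '' J ∩ J).Nonempty) : ∀ t ∈ J, h t = t := by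
  obtain ⟨w, rfl⟩ := P.exists_val_eq hh
  obtain ⟨v, hv, hv', -⟩ := P.exists_reduced hJ (u := []) trivial w (Or.inr hJf)
  simp only [val_nil, RelIso.one_apply] at hv'
  -- A nonempty reduced word would map all of `J` into a foot, away from `J`.
  cases v with
  | nil => simpa using hv'
  | cons a v =>
    obtain ⟨_, ⟨x, hx, rfl⟩, hx'⟩ := hne
    rw [hv' x hx] at hx'
    exact absurd (hv.mem_foot hx) (Set.disjoint_left.1 (hJf a) hx')

/-- If `K` is disjoint from all feet but those of the letter `c` and its inverse, then near the
left part of `K` an element of the group that has a fixed point there acts as a power of `c`. -/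
theorem eq_zpow_of_fixed {x₀ x s : α} {c : ι} (hs : x < s)
    (hx₀ : P.act c x₀ = x₀) (hx : P.act c x = x)
    (hd : ∀ b, b ≠ c → b ≠ P.inv c → Disjoint (Ico x₀ s) (P.foot b))
    (hc : ¬ Disjoint (Ico x₀ s) (P.foot c)) (hc' : ¬ Disjoint (Ico x₀ s) (P.foot (P.inv c)))
    {h : α ≃o α} (hh : h ∈ P.group) {z : α} (hz : z ∈ Ico x₀ x) (hhz : h z = z) :
    ∃ k : ℤ, ∃ y, x < y ∧ ∀ t ∈ Ico x₀ y, h t = (P.act c ^ k) t := by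
  have hK : (Ico x₀ s).OrdConnected := ordConnected_Ico
  have hinv : ∀ b, b ≠ c → b ≠ P.inv c → P.inv b ≠ c ∧ P.inv b ≠ P.inv c := by
    intro b h1 h2
    refine ⟨fun e => h2 ?_, fun e => h1 ?_⟩
    · rw [← e, P.inv_inv]
    · rw [← P.inv_inv b, e, P.inv_inv]
  have hxk : ∀ k : ℤ, (P.act c ^ k) x = x := zpow_apply_eq_self hx
  have hx₀k : ∀ k : ℤ, (P.act c ^ k) x₀ = x₀ := zpow_apply_eq_self hx₀
  -- Powers of `c` are collected on the right: both feet of `c` meet `[x₀, s)`, so no reduced word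
  -- on it can start acting with `c` or its inverse. The bound `y` is shrunk so that the power keeps
  -- `[x₀, y)` inside `[x₀, s)`.
  have words : ∀ w : List ι, ∃ u, P.Reduced (Ico x₀ s) u ∧ ∃ k : ℤ, ∃ y, x < y ∧
      ∀ t ∈ Ico x₀ y, (P.act c ^ k) t ∈ Ico x₀ s ∧ P.val w t = P.val u ((P.act c ^ k) t) := by
    intro w
    induction w with
    | nil => exact ⟨[], trivial, 0, s, hs, fun t ht => ⟨by simpa using ht, by simp⟩⟩
    | cons b w ih =>
      obtain ⟨u, hu, k, y, hy, huy⟩ := ih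
      by_cases hub : u = [] ∧ (b = c ∨ b = P.inv c)
      · obtain ⟨rfl, hb⟩ := hub
        obtain ⟨k', hk'⟩ : ∃ k' : ℤ, P.act b * P.act c ^ k = P.act c ^ k' := by
          rcases hb with rfl | rfl
          · exact ⟨1 + k, by rw [zpow_add, zpow_one]⟩
          · exact ⟨-1 + k, by rw [zpow_add, zpow_neg_one, P.act_inv]⟩
        refine ⟨[], trivial, k', min y ((P.act c ^ (-k')) s), ?_, ?_⟩
        · refine lt_min hy ?_
          conv_lhs => rw [← hxk (-k')]
          exact (OrderIso.lt_iff_lt _).2 hs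
        · intro t ht
          refine ⟨⟨?_, ?_⟩, ?_⟩
          · rw [← hx₀k k']
            exact (OrderIso.le_iff_le _).2 ht.1
          · have := (P.act c ^ k').lt_iff_lt.2 (ht.2.trans_le (min_le_right _ _))
            rwa [← RelIso.mul_apply, ← zpow_add, add_neg_cancel, zpow_zero] at this
          · have := (huy t ⟨ht.1, ht.2.trans_le (min_le_left _ _)⟩).2
            rw [val_cons, RelIso.mul_apply, this, ← hk']
            simp
      · obtain ⟨v, hv, hv', -⟩ := P.exists_reduced_act hK hu b (by
          by_cases e : u = []
          · have hb : b ≠ c ∧ b ≠ P.inv c := by tauto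
            have hb' := hinv b hb.1 hb.2
            exact Or.inr ⟨hd b hb.1 hb.2, hd _ hb'.1 hb'.2⟩
          · exact Or.inl e)
        refine ⟨v, hv, k, y, hy, fun t ht => ⟨(huy t ht).1, ?_⟩⟩
        rw [val_cons, RelIso.mul_apply, (huy t ht).2, hv' _ (huy t ht).1]
  -- If the value lies in `[x₀, x)`, the outermost letter is `c` or its inverse, as no other foot
  -- meets that interval. Both preserve `[x₀, x)`, so the letter can be peeled off; the innermost
  -- letter would then be `c` or its inverse, which was excluded.
  have nil : ∀ u, P.Reduced (Ico x₀ s) u → ∀ t ∈ Ico x₀ s, P.val u t ∈ Ico x₀ x → u = [] := by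
    intro u
    induction u with
    | nil => intros; rfl
    | cons a u ih =>
      intro hu t ht hut
      have ha : a = c ∨ a = P.inv c := by
        by_contra! hac
        exact Set.disjoint_left.1 (hd a hac.1 hac.2) ⟨hut.1, hut.2.trans hs⟩ (hu.mem_foot ht)
      have hfix : ∀ r, P.act c r = r → P.act (P.inv a) r = r := by
        intro r hr
        rcases ha with rfl | rfl
        · conv_lhs => rw [← hr]
          exact P.act_inv_act _ _
        · rwa [P.inv_inv]
      have hut' : P.val u t ∈ Ico x₀ x := by
        rw [← P.act_inv_act a (P.val u t), ← RelIso.mul_apply (P.act a), ← val_cons]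
        constructor
        · conv_lhs => rw [← hfix x₀ hx₀]
          exact (OrderIso.le_iff_le _).2 hut.1
        · conv_rhs => rw [← hfix x hx]
          exact (OrderIso.lt_iff_lt _).2 hut.2
      obtain rfl := ih hu.1 t ht hut'
      have h2 := fun x hx => (hu.2 x hx).2
      simp only [val_nil, RelIso.one_apply] at h2
      rcases ha with rfl | rfl
      · exact absurd (Set.disjoint_left.2 h2) hc'
      · rw [P.inv_inv] at h2
        exact absurd (Set.disjoint_left.2 h2) hc
  obtain ⟨w, rfl⟩ := P.exists_val_eq hh
  obtain ⟨u, hu, k, y, hy, huy⟩ := words w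
  have hzy := huy z ⟨hz.1, hz.2.trans hy⟩
  obtain rfl := nil u hu _ hzy.1 (by rw [← hzy.2, hhz]; exact hz)
  exact ⟨k, y, hy, fun t ht => (huy t ht).2⟩

/-! ### Rigidity from ping-pong histories -/

/-- `h` is the identity on some interval `[x, y)`. -/
def LocallyTrivial (h : α ≃o α) (x : α) : Prop :=
  ∀ z, x < z → ∃ y, x < y ∧ ∀ t ∈ Ico x y, h t = t

/-- Elements of the group that fix `X` and `x` are the identity immediately to the right of `x`. -/
def Rigid (X : Set α) (x : α) : Prop :=
  ∀ h ∈ P.group, (∀ t ∈ X, h t = t) → h x = x → LocallyTrivial h x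

lemma Rigid.apply {P : PingPong ι α} {X : Set α} (hX : ∀ g ∈ P.group, ∀ t ∈ X, g t ∈ X) {x : α}
    (hx : P.Rigid X x) {g : α ≃o α} (hg : g ∈ P.group) : P.Rigid X (g x) := by
  intro h hh hhX hhx z hz
  have h1 := hx (g⁻¹ * h * g) (mul_mem (mul_mem (inv_mem hg) hh) hg) (fun t ht => by
    rw [RelIso.mul_apply, RelIso.mul_apply, hhX _ (hX g hg t ht), orderIso_inv_apply_self]) (by
    rw [RelIso.mul_apply, RelIso.mul_apply, hhx, orderIso_inv_apply_self])
  obtain ⟨y, hy, hy'⟩ := h1 (g⁻¹ z) (by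
    rw [← orderIso_inv_apply_self g x]
    exact (OrderIso.lt_iff_lt _).2 hz)
  refine ⟨g y, (OrderIso.lt_iff_lt _).2 hy, fun t ht => ?_⟩
  have h2 := hy' (g⁻¹ t) ⟨?_, ?_⟩
  · rw [RelIso.mul_apply, RelIso.mul_apply, orderIso_apply_inv_self] at h2
    exact g⁻¹.injective h2
  · rw [← orderIso_inv_apply_self g x]
    exact (OrderIso.le_iff_le _).2 ht.1
  · rw [← orderIso_inv_apply_self g y]
    exact (OrderIso.lt_iff_lt _).2 ht.2

/-- `E` is a set of points near `x` in the foot of the letter `a`, invariant under that letter, that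
contains a point of `X` moved by `a`. -/
structure IsAnchor (X E : Set α) (a : ι) (x : α) : Prop where
  ordConnected : E.OrdConnected
  subset_foot : E ⊆ P.foot a
  mapsTo : ∀ t ∈ E, P.act a t ∈ E
  mem : x ∈ E
  nhds : ∃ y, x < y ∧ Ico x y ⊆ E
  exists_mem : ∃ t ∈ X, t ∈ E ∧ P.act a t ≠ t

section Anchor

variable {P} {X E : Set α} {a : ι} {x : α}

/-- Evaluating at `a ^ k` of a point `y₀` of `X` in `E` shows that the word sends that point to
`y₀`, which lies in the foot of `a`. So the head of the word is `a`; it is absorbed into the power,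
and the induction would give `k + 1 = 0`. -/
lemma IsAnchor.eq_nil (hE : P.IsAnchor X E a x) (hX : ∀ g ∈ P.group, ∀ t ∈ X, g t ∈ X)
    {z : List ι} (hz : P.Reduced E z) (k : ℕ)
    (h : ∀ y ∈ X, y ∈ E → (P.act a ^ k) (P.val z y) = y) : z = [] ∧ k = 0 := by
  obtain ⟨y₀, hy₀, hy₀E, hne⟩ := hE.exists_mem
  induction z generalizing k with
  | nil =>
    refine ⟨rfl, ?_⟩
    by_contra hk
    exact pow_apply_ne hne hk (h y₀ hy₀ hy₀E)
  | cons b z ih =>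
    exfalso
    have hpow : ∀ n : ℕ, (P.act a ^ n) y₀ ∈ E := by
      intro n
      induction n with
      | zero => exact hy₀E
      | succ n ihn =>
        rw [pow_succ', RelIso.mul_apply]
        exact hE.mapsTo _ ihn
    have h1 := h _ (hX _ (pow_mem (P.act_mem a) k) _ hy₀) (hpow k)
    have h2 : P.val (b :: z) ((P.act a ^ k) y₀) = y₀ := (P.act a ^ k).injective h1
    have h3 := hz.mem_foot (hpow k)
    rw [h2] at h3
    obtain rfl := P.foot_eq h3 (hE.subset_foot hy₀E)
    have := (ih hz.1 (k + 1) fun y hy hyE => by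
      have := h y hy hyE
      rwa [val_cons, RelIso.mul_apply, ← RelIso.mul_apply, ← pow_succ] at this).2
    omega

/-- The value at one point of `X` in `E` lies in the feet of both heads, so the heads agree and can
be cancelled. `IsAnchor.eq_nil` handles the case where one word runs out first. -/
lemma IsAnchor.reduced_unique (hE : P.IsAnchor X E a x) (hX : ∀ g ∈ P.group, ∀ t ∈ X, g t ∈ X)
    {u v : List ι} (hu : P.Reduced E u) (hv : P.Reduced E v)
    (h : ∀ y ∈ X, y ∈ E → P.val u y = P.val v y) : u = v := by
  induction u generalizing v with
  | nil => exact (hE.eq_nil hX hv 0 fun y hy hyE => (h y hy hyE).symm).1.symm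
  | cons b u ih =>
    cases v with
    | nil => exact (hE.eq_nil hX hu 0 fun y hy hyE => h y hy hyE).1
    | cons c v =>
      obtain ⟨y₀, hy₀, hy₀E, -⟩ := hE.exists_mem
      have h1 := hu.mem_foot hy₀E
      rw [h y₀ hy₀ hy₀E] at h1
      obtain rfl := P.foot_eq h1 (hv.mem_foot hy₀E)
      rw [ih hu.1 hv.1 fun y hy hyE => by
        have := h y hy hyE
        rw [val_cons, val_cons] at this
        exact (P.act b).injective this]

end Anchor

/-- If every point in a foot is rigid or anchored by the invariant set `X`, then all points are
rigid. -/
theorem rigid_of_anchors {X : Set α} (hX : ∀ g ∈ P.group, ∀ t ∈ X, g t ∈ X)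
    (hgap : ∀ x z, x < z → (∀ a, x ∉ P.foot a) →
      ∃ y, x < y ∧ ∀ a, Disjoint (Ico x y) (P.foot a))
    (hfoot : ∀ a, ∀ x ∈ P.foot a, P.Rigid X x ∨ ∃ E, P.IsAnchor X E a x) (x : α) :
    P.Rigid X x := by
  by_contra hx
  -- Outside the feet, `hgap` gives an interval to the right of the point that misses all feet, and
  -- ping-pong consistency applies to it.
  have hmem : ∀ x, ¬ P.Rigid X x → ∃ a, x ∈ P.foot a := by
    intro x hx
    by_contra! hxf
    refine hx fun h hh _ hhx z hz => ?_
    obtain ⟨y, hy, hyf⟩ := hgap x z hz hxf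
    exact ⟨y, hy, P.consistent ordConnected_Ico hyf hh
      ⟨x, ⟨x, ⟨le_rfl, hy⟩, hhx⟩, ⟨le_rfl, hy⟩⟩⟩
  -- Failure of rigidity passes to preimages, so a point where it fails can be pulled back out of
  -- its foot `N` times; the letters used form a reduced word on an anchor.
  have key : ∀ (N : ℕ) (x : α), ¬ P.Rigid X x → ∃ E a₀ x' u, P.IsAnchor X E a₀ x' ∧
      P.Reduced E u ∧ u.length = N ∧ P.val u x' = x := by
    intro N
    induction N with
    | zero =>
      intro x hx
      obtain ⟨a, ha⟩ := hmem x hx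
      obtain ⟨E, hE⟩ := (hfoot a x ha).resolve_left hx
      exact ⟨E, a, x, [], hE, trivial, rfl, rfl⟩
    | succ N ih =>
      intro x hx
      obtain ⟨b, hb⟩ := hmem x hx
      have hx' : ¬ P.Rigid X (P.act (P.inv b) x) := by
        intro h
        apply hx
        rw [← P.act_act_inv b x]
        exact h.apply hX (P.act_mem b)
      obtain ⟨E, a₀, x', u, hE, hu, hl, hux⟩ := ih _ hx'
      have hback := P.back b x hb
      rw [← hux] at hback
      refine ⟨E, a₀, x', b :: u, hE, ⟨hu, ?_⟩, by simp [hl], by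
        rw [val_cons, RelIso.mul_apply, hux, P.act_act_inv]⟩
      obtain ⟨c, hc⟩ : ∃ c, P.val u '' E ⊆ P.foot c := by
        cases u with
        | nil => exact ⟨a₀, by simpa using hE.subset_foot⟩
        | cons c u =>
          refine ⟨c, ?_⟩
          rintro _ ⟨t, ht, rfl⟩
          exact hu.mem_foot ht
      have hcb : c ≠ P.inv b := by
        rintro rfl
        exact hback.2 (hc (mem_image_of_mem _ hE.mem))
      rcases P.subset_moved_or (ordConnected_image_orderIso (P.val u) hE.ordConnected)
        (Or.inr ⟨c, hc, hcb⟩) with h | h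
      · exact fun t ht => h _ (mem_image_of_mem _ ht)
      · exact absurd hback.1 (h _ (mem_image_of_mem _ hE.mem))
  apply hx
  intro h hh hhX hhx z hz
  obtain ⟨w, rfl⟩ := P.exists_val_eq hh
  obtain ⟨E, a₀, x', u, hE, hu, hl, rfl⟩ := key w.length x hx
  -- The history was chosen as long as the word for `h`, so reduction cannot use it up early.
  obtain ⟨v, hv, hv', -⟩ := P.exists_reduced hE.ordConnected hu w (Or.inl hl.ge)
  have huv : u = v := hE.reduced_unique hX hu hv fun y hy hyE => by
    rw [← hv' y hyE, hhX _ (hX _ (P.val_mem u) y hy)]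
  subst huv
  obtain ⟨y, hy, hyE⟩ := hE.nhds
  refine ⟨P.val u y, (OrderIso.lt_iff_lt _).2 hy, fun t ht => ?_⟩
  have h1 : (P.val u)⁻¹ t ∈ E := hyE ⟨by
    rw [← orderIso_inv_apply_self (P.val u) x']
    exact (OrderIso.le_iff_le _).2 ht.1, by
    rw [← orderIso_inv_apply_self (P.val u) y]
    exact (OrderIso.lt_iff_lt _).2 ht.2⟩
  have h2 := hv' _ h1
  rwa [orderIso_apply_inv_self] at h2

end PingPong
end OscGroups

/-! ### Wreath products from consistent and faithful actions -/

namespace OscGroups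

/-- Groups `G` and `H` of homeomorphisms such that `G` is supported in the interval `J` and `H` acts
faithfully and consistently on the translates of `J`. -/
structure WreathPair (G H : Subgroup (I ≃o I)) (J : Set I) : Prop where
  ordConnected : J.OrdConnected
  nonempty : J.Nonempty
  fix : ∀ g ∈ G, ∀ t ∉ J, g t = t
  consistent : IsConsistent H J
  faithful : FaithfulSMul H (MulAction.orbit H J)

namespace WreathPair

variable {G H : Subgroup (I ≃o I)} {J : Set I}

lemma apply_mem (hw : WreathPair G H J) {g : I ≃o I} (hg : g ∈ G) {t : I} (ht : t ∈ J) :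
    g t ∈ J := by
  by_contra h
  have := hw.fix g⁻¹ (inv_mem hg) _ h
  rw [orderIso_inv_apply_self] at this
  exact h (this ▸ ht)

/-- Consistency applied to `h⁻¹ * k`, which carries `k⁻¹ • t` to `h⁻¹ • t`. This makes the chosen
representatives in `baseFun` and `orbitFun` irrelevant. -/
lemma eqOn_of_mem (hw : WreathPair G H J) {h k : H} {t : I} (hh : h⁻¹ • t ∈ J)
    (hk : k⁻¹ • t ∈ J) : ∀ s ∈ J, k • s = h • s := by
  intro s hs
  have := hw.consistent (h⁻¹ * k : H) (h⁻¹ * k).2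
    ⟨h⁻¹ • t, ⟨k⁻¹ • t, hk, by
      change (h⁻¹ * k) • k⁻¹ • t = h⁻¹ • t
      rw [mul_smul, smul_inv_smul]⟩, hh⟩ s hs
  change (h⁻¹ * k) • s = s at this
  rw [mul_smul] at this
  rw [← this, smul_inv_smul, this]

lemma smul_eq_of_mem (hw : WreathPair G H J) {h k : H} {t : I} (hh : h⁻¹ • t ∈ J)
    (hk : k⁻¹ • t ∈ J) : k • J = h • J :=
  Set.image_congr (hw.eqOn_of_mem hh hk)

lemma eqOn_of_smul_eq (hw : WreathPair G H J) {h k : H} (e : k • J = h • J) :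
    ∀ s ∈ J, k • s = h • s := by
  obtain ⟨s, hs⟩ := hw.nonempty
  refine hw.eqOn_of_mem (t := h • s) (by simpa using hs) ?_
  rw [← Set.mem_smul_set_iff_inv_smul_mem, e]
  exact Set.smul_mem_smul_set hs

lemma exists_smul_eq (y : MulAction.orbit H J) :
    ∃ h : H, y = ⟨h • J, MulAction.mem_orbit J h⟩ := by
  obtain ⟨y, h, rfl⟩ := y
  exact ⟨h, rfl⟩

open Classical in
/-- The map acting on the translate `hJ` as the conjugate by `h` of the value of `φ` at `hJ`. -/
noncomputable def baseFun (φ : MulAction.orbit H J → G) (t : I) : I :=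
  if h : ∃ k : H, k⁻¹ • t ∈ J then
    h.choose • φ ⟨h.choose • J, MulAction.mem_orbit J _⟩ • h.choose⁻¹ • t
  else t

lemma baseFun_eq (hw : WreathPair G H J) (φ : MulAction.orbit H J → G) {k : H} {t : I}
    (ht : k⁻¹ • t ∈ J) :
    baseFun φ t = k • φ ⟨k • J, MulAction.mem_orbit J k⟩ • k⁻¹ • t := by
  have hex : ∃ k : H, k⁻¹ • t ∈ J := ⟨k, ht⟩
  rw [baseFun, dif_pos hex]
  have hJ := hw.smul_eq_of_mem ht hex.choose_spec
  have hE := hw.eqOn_of_mem ht hex.choose_spec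
  have hphi : φ ⟨hex.choose • J, MulAction.mem_orbit J _⟩ =
      φ ⟨k • J, MulAction.mem_orbit J k⟩ := congrArg φ (Subtype.ext hJ)
  have hin : hex.choose⁻¹ • t = k⁻¹ • t := by
    rw [inv_smul_eq_iff, hE _ ht, smul_inv_smul]
  rw [hphi, hin]
  exact hE _ (hw.apply_mem (φ _).2 ht)

lemma baseFun_of_forall (φ : MulAction.orbit H J → G) {t : I} (ht : ∀ k : H, k⁻¹ • t ∉ J) :
    baseFun φ t = t := by
  rw [baseFun, dif_neg]
  push Not
  exact ht

lemma baseFun_mem (hw : WreathPair G H J) (φ : MulAction.orbit H J → G) {k : H} {t : I}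
    (ht : k⁻¹ • t ∈ J) : k⁻¹ • baseFun φ t ∈ J := by
  rw [hw.baseFun_eq φ ht, inv_smul_smul]
  exact hw.apply_mem (φ _).2 ht

lemma baseFun_mul (hw : WreathPair G H J) (φ ψ : MulAction.orbit H J → G) (t : I) :
    baseFun (φ * ψ) t = baseFun φ (baseFun ψ t) := by
  by_cases ht : ∃ k : H, k⁻¹ • t ∈ J
  · obtain ⟨k, hk⟩ := ht
    rw [hw.baseFun_eq φ (hw.baseFun_mem ψ hk), hw.baseFun_eq ψ hk, hw.baseFun_eq _ hk,
      inv_smul_smul, Pi.mul_apply, mul_smul]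
  · push Not at ht
    rw [baseFun_of_forall _ ht, baseFun_of_forall ψ ht, baseFun_of_forall _ ht]

lemma baseFun_one (hw : WreathPair G H J) (t : I) :
    baseFun (1 : MulAction.orbit H J → G) t = t := by
  by_cases ht : ∃ k : H, k⁻¹ • t ∈ J
  · obtain ⟨k, hk⟩ := ht
    rw [hw.baseFun_eq _ hk, Pi.one_apply, one_smul, smul_inv_smul]
  · push Not at ht
    exact baseFun_of_forall _ ht

/-- The translates are disjoint and convex, and each is preserved. Inside one translate the map is a
conjugate of an increasing map; points not in a common translate keep their order because a point
outside a convex set lies on one side of it. -/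
lemma baseFun_strictMono (hw : WreathPair G H J) (φ : MulAction.orbit H J → G) :
    StrictMono (baseFun φ) := by
  have hc : ∀ k : H, (k • J : Set I).OrdConnected := fun k =>
    ordConnected_image_orderIso k.1 hw.ordConnected
  have hm : ∀ {k : H} {t : I}, k⁻¹ • t ∈ J ↔ t ∈ k • J := fun {k t} =>
    Set.mem_smul_set_iff_inv_smul_mem.symm
  have hmem : ∀ (k : H) (t : I), t ∈ k • J ↔ baseFun φ t ∈ k • J := by
    intro k t
    refine ⟨fun h => hm.1 (hw.baseFun_mem φ (hm.2 h)), fun h => ?_⟩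
    have := hm.1 (hw.baseFun_mem φ⁻¹ (hm.2 h))
    rwa [← hw.baseFun_mul, inv_mul_cancel, hw.baseFun_one] at this
  intro s t hst
  have hlt : ∀ (k : H) (r r' : I), r ∈ k • J → r' ∉ k • J → r < r' → ∀ q ∈ k • J, q < r' := by
    intro k r r' hr hr' hrr q hq
    by_contra! h
    exact hr' ((hc k).out hr hq ⟨hrr.le, h⟩)
  have hgt : ∀ (k : H) (r r' : I), r ∈ k • J → r' ∉ k • J → r' < r → ∀ q ∈ k • J, r' < q := by
    intro k r r' hr hr' hrr q hq
    by_contra! h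
    exact hr' ((hc k).out hq hr ⟨h, hrr.le⟩)
  by_cases hs : ∃ k : H, s ∈ k • J
  · obtain ⟨k, hk⟩ := hs
    by_cases htk : t ∈ k • J
    · rw [hw.baseFun_eq φ (hm.2 hk), hw.baseFun_eq φ (hm.2 htk)]
      exact (k.1).lt_iff_lt.2 ((φ ⟨k • J, MulAction.mem_orbit J k⟩).1.lt_iff_lt.2
        ((k⁻¹).1.lt_iff_lt.2 hst))
    · have h1 := hlt k s t hk htk hst _ ((hmem k s).1 hk)
      by_cases ht : ∃ l : H, t ∈ l • J
      · obtain ⟨l, hl⟩ := ht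
        refine hgt l t _ hl ?_ h1 _ ((hmem l t).1 hl)
        intro h
        have hsl := (hmem l s).2 h
        exact htk ((hw.smul_eq_of_mem (hm.2 hk) (hm.2 hsl)) ▸ hl)
      · push Not at ht
        rwa [baseFun_of_forall φ fun l h => ht l (hm.1 h)]
  · push Not at hs
    rw [baseFun_of_forall φ fun l h => hs l (hm.1 h)]
    by_cases ht : ∃ l : H, t ∈ l • J
    · obtain ⟨l, hl⟩ := ht
      exact hgt l t s hl (hs l) hst _ ((hmem l t).1 hl)
    · push Not at ht
      rwa [baseFun_of_forall φ fun l h => ht l (hm.1 h)]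

/-- The action on `I` of the direct product of copies of `G` indexed by the translates of `J`. -/
noncomputable def baseHom (hw : WreathPair G H J) : (MulAction.orbit H J → G) →* (I ≃o I) where
  toFun φ := StrictMono.orderIsoOfRightInverse (baseFun φ) (hw.baseFun_strictMono φ) (baseFun φ⁻¹)
    fun t => by rw [← hw.baseFun_mul, mul_inv_cancel, hw.baseFun_one]
  map_one' := by
    refine OrderIso.ext (funext fun t => ?_)
    exact hw.baseFun_one t
  map_mul' φ ψ := by
    refine OrderIso.ext (funext fun t => ?_)
    exact hw.baseFun_mul φ ψ t

lemma baseHom_apply (hw : WreathPair G H J) (φ : MulAction.orbit H J → G) (t : I) :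
    hw.baseHom φ t = baseFun φ t := rfl

/-- The action of the wreath product `G ≀ H` on `I`. -/
noncomputable def wreathHom (hw : WreathPair G H J) :
    PermWreath G H (MulAction.orbit H J) →* (I ≃o I) :=
  SemidirectProduct.lift (hw.baseHom.comp (directSum G (MulAction.orbit H J)).subtype) H.subtype
    (by
      intro h
      ext φ : 1
      refine OrderIso.ext (funext fun t => ?_)
      change baseFun (fun y => φ.1 (h⁻¹ • y)) t = h • baseFun φ.1 (h⁻¹ • t)
      by_cases ht : ∃ k : H, k⁻¹ • t ∈ J
      · obtain ⟨k, hk⟩ := ht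
        have hk' : (h⁻¹ * k)⁻¹ • h⁻¹ • t ∈ J := by
          rw [mul_inv_rev, mul_smul, inv_inv, smul_inv_smul]
          exact hk
        rw [hw.baseFun_eq _ hk, hw.baseFun_eq _ hk']
        have e : h⁻¹ • (⟨k • J, MulAction.mem_orbit J k⟩ : MulAction.orbit H J) =
            ⟨(h⁻¹ * k) • J, MulAction.mem_orbit J (h⁻¹ * k)⟩ :=
          Subtype.ext (mul_smul _ _ _).symm
        have hkk : ∀ s : I, h • (h⁻¹ * k) • s = k • s := fun s => by
          rw [mul_smul, smul_inv_smul]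
        rw [e, mul_inv_rev, mul_smul k⁻¹, inv_inv, smul_inv_smul, hkk]
      · push Not at ht
        rw [baseFun_of_forall _ ht, baseFun_of_forall, smul_inv_smul]
        intro k
        have := ht (h * k)
        rwa [mul_inv_rev, mul_smul] at this)

lemma wreathHom_apply (hw : WreathPair G H J) (w : PermWreath G H (MulAction.orbit H J)) (t : I) :
    hw.wreathHom w t = baseFun w.left.1 (w.right • t) := rfl

lemma wreathHom_injective (hw : WreathPair G H J) : Function.Injective hw.wreathHom := by
  rw [injective_iff_map_eq_one]
  intro w e
  have hbase : ∀ t, baseFun w.left.1 (w.right • t) = t := fun t => by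
    rw [← hw.wreathHom_apply, e]
    rfl
  -- The base part preserves each translate, so if the product is the identity, then `w.right` fixes
  -- each translate too, and faithfulness applies.
  have hr : w.right = 1 := by
    refine hw.faithful.eq_of_smul_eq_smul fun y => ?_
    obtain ⟨k, rfl⟩ := exists_smul_eq y
    obtain ⟨s, hs⟩ := hw.nonempty
    apply Subtype.ext
    change w.right • k • J = (1 : H) • k • J
    rw [one_smul, ← mul_smul]
    have h1 : (w.right * k)⁻¹ • w.right • k • s ∈ J := by
      rw [← mul_smul w.right, inv_smul_smul]
      exact hs
    have h2 := hw.baseFun_mem w.left.1 h1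
    rw [hbase] at h2
    exact hw.smul_eq_of_mem (by rwa [inv_smul_smul]) h2
  have hl : w.left = 1 := by
    apply Subtype.ext
    funext y
    obtain ⟨k, rfl⟩ := exists_smul_eq y
    apply Subtype.ext
    refine OrderIso.ext (funext fun t => ?_)
    by_cases ht : t ∈ J
    · have h1 := hbase (k • t)
      rw [hr, one_smul, hw.baseFun_eq w.left.1 (by rwa [inv_smul_smul]), inv_smul_smul] at h1
      exact smul_left_cancel k h1
    · exact hw.fix _ (w.left.1 _).2 _ ht
  exact SemidirectProduct.ext hl hr

open Classical in
lemma baseHom_single (hw : WreathPair G H J) (k : H) (g : G) :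
    hw.baseHom (Pi.mulSingle ⟨k • J, MulAction.mem_orbit J k⟩ g) = k.1 * g.1 * k.1⁻¹ := by
  refine OrderIso.ext (funext fun t => ?_)
  rw [hw.baseHom_apply]
  change _ = k • g • k⁻¹ • t
  by_cases ht : k⁻¹ • t ∈ J
  · rw [hw.baseFun_eq _ ht, Pi.mulSingle_eq_same]
  · have h1 : g • k⁻¹ • t = k⁻¹ • t := hw.fix _ g.2 _ ht
    rw [h1, smul_inv_smul]
    by_cases ht' : ∃ l : H, l⁻¹ • t ∈ J
    · obtain ⟨l, hl⟩ := ht'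
      rw [hw.baseFun_eq _ hl, Pi.mulSingle_eq_of_ne, one_smul, smul_inv_smul]
      intro e
      have e' : l • J = k • J := congrArg Subtype.val e
      rw [← Set.mem_smul_set_iff_inv_smul_mem] at hl ht
      exact ht (e' ▸ hl)
    · push Not at ht'
      exact baseFun_of_forall _ ht'

-- Finite support is what is needed here: one coordinate is split off at a time, and each acts as a
-- conjugate of an element of `G` by an element of `H`.
open Classical in
lemma baseHom_mem (hw : WreathPair G H J) {K : Subgroup (I ≃o I)} (hG : G ≤ K) (hH : H ≤ K)
    (s : Finset (MulAction.orbit H J)) (φ : MulAction.orbit H J → G) (hφ : ∀ y ∉ s, φ y = 1) :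
    hw.baseHom φ ∈ K := by
  induction s using Finset.induction_on generalizing φ with
  | empty =>
    have : φ = 1 := funext fun y => hφ y (by simp)
    rw [this, map_one]
    exact one_mem _
  | insert y s _ ih =>
    have h : φ = Pi.mulSingle y (φ y) * Function.update φ y 1 := by
      funext z
      by_cases hz : z = y
      · subst hz
        simp
      · simp [hz]
    rw [h, map_mul]
    refine mul_mem ?_ (ih _ fun z hz => ?_)
    · obtain ⟨k, rfl⟩ := exists_smul_eq y
      rw [baseHom_single]
      exact mul_mem (mul_mem (hH k.2) (hG (φ _).2)) (inv_mem (hH k.2))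
    · by_cases hzy : z = y
      · simp [hzy]
      · simp [hzy, hφ z (by simp [hzy, hz])]

lemma wreathHom_range (hw : WreathPair G H J) : hw.wreathHom.range = G ⊔ H := by
  classical
  apply le_antisymm
  · rintro _ ⟨w, rfl⟩
    have : hw.wreathHom w = hw.baseHom w.left.1 * w.right.1 := rfl
    rw [this]
    refine mul_mem (hw.baseHom_mem le_sup_left le_sup_right w.left.2.toFinset _ ?_)
      ((le_sup_right : H ≤ G ⊔ H) w.right.2)
    intro y hy
    by_contra h
    exact hy (w.left.2.mem_toFinset.2 h)
  · refine sup_le (fun g hg => ?_) fun h hh => ?_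
    · let φ : MulAction.orbit H J → G :=
        Pi.mulSingle ⟨(1 : H) • J, MulAction.mem_orbit J 1⟩ ⟨g, hg⟩
      have hφ : φ ∈ directSum G (MulAction.orbit H J) := by
        refine (Set.finite_singleton (⟨(1 : H) • J, MulAction.mem_orbit J 1⟩ :
          MulAction.orbit H J)).subset fun y hy => ?_
        by_contra hne
        exact hy (Pi.mulSingle_eq_of_ne hne _)
      refine ⟨⟨⟨φ, hφ⟩, 1⟩, ?_⟩
      have : hw.wreathHom ⟨⟨φ, hφ⟩, 1⟩ = hw.baseHom φ * 1 := rfl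
      rw [this, mul_one, baseHom_single]
      simp
    · refine ⟨⟨1, ⟨h, hh⟩⟩, ?_⟩
      have : hw.wreathHom ⟨1, ⟨h, hh⟩⟩ = hw.baseHom 1 * h := rfl
      rw [this, map_one, one_mul]

/-- The map `(x, hJ) ↦ h x`. -/
noncomputable def orbitFun (x : I) (y : MulAction.orbit H J) : I :=
  (exists_smul_eq y).choose • x

lemma orbitFun_eq (hw : WreathPair G H J) {x : I} (hx : x ∈ J) (h : H) :
    orbitFun x (⟨h • J, MulAction.mem_orbit J h⟩ : MulAction.orbit H J) = h • x :=
  hw.eqOn_of_smul_eq (congrArg Subtype.val (exists_smul_eq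
    (⟨h • J, MulAction.mem_orbit J h⟩ : MulAction.orbit H J)).choose_spec).symm x hx

theorem exists_equiv (hw : WreathPair G H J) {t₀ : I} (ht₀ : t₀ ∈ J) {K : Subgroup (I ≃o I)}
    (hK : K = G ⊔ H) :
    ∃ (Φ : PermWreath G H (MulAction.orbit H J) ≃* K)
      (Ψ : MulAction.orbit G t₀ × MulAction.orbit H J ≃ MulAction.orbit K t₀),
      (∀ (x : MulAction.orbit G t₀) (h : H),
        (Ψ (x, ⟨h • J, MulAction.mem_orbit J h⟩) : I) = h • (x : I)) ∧
      ∀ (w : PermWreath G H (MulAction.orbit H J))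
        (z : MulAction.orbit G t₀ × MulAction.orbit H J), Ψ (w • z) = Φ w • Ψ z := by
  have hX : ∀ x : MulAction.orbit G t₀, (x : I) ∈ J := by
    rintro ⟨_, g, rfl⟩
    exact hw.apply_mem g.2 ht₀
  have hGK : G ≤ K := hK ▸ le_sup_left
  have hHK : H ≤ K := hK ▸ le_sup_right
  let Φ : PermWreath G H (MulAction.orbit H J) ≃* K :=
    (MonoidHom.ofInjective hw.wreathHom_injective).trans
      (MulEquiv.subgroupCongr (hw.wreathHom_range.trans hK.symm))
  have hΦ : ∀ w (t : I), Φ w • t = baseFun w.left.1 (w.right • t) := fun w t => rfl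
  let ψ : MulAction.orbit G t₀ × MulAction.orbit H J → I := fun z => orbitFun z.1 z.2
  have hψ : ∀ (x : MulAction.orbit G t₀) (h : H),
      ψ (x, ⟨h • J, MulAction.mem_orbit J h⟩) = h • (x : I) := fun x h => hw.orbitFun_eq (hX x) h
  have hequi : ∀ w z, ψ (w • z) = Φ w • ψ z := by
    rintro w ⟨x, y⟩
    obtain ⟨k, rfl⟩ := exists_smul_eq y
    have e : w • (x, (⟨k • J, MulAction.mem_orbit J k⟩ : MulAction.orbit H J)) =
        (w.left.1 ⟨(w.right * k) • J, MulAction.mem_orbit J _⟩ • x,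
          ⟨(w.right * k) • J, MulAction.mem_orbit J _⟩) := by
      have e' : w.right • (⟨k • J, MulAction.mem_orbit J k⟩ : MulAction.orbit H J) =
          ⟨(w.right * k) • J, MulAction.mem_orbit J _⟩ := Subtype.ext (mul_smul _ _ _).symm
      rw [← e']
      rfl
    have hin : (w.right * k)⁻¹ • w.right • k • (x : I) ∈ J := by
      rw [← mul_smul w.right, inv_smul_smul]
      exact hX x
    rw [e, hψ, hψ, hΦ, hw.baseFun_eq _ hin, ← mul_smul w.right, inv_smul_smul]
    rfl
  have hmem : ∀ z, ψ z ∈ MulAction.orbit K t₀ := by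
    rintro ⟨⟨_, g, rfl⟩, y⟩
    obtain ⟨k, rfl⟩ := exists_smul_eq y
    rw [hψ]
    exact ⟨⟨k.1, hHK k.2⟩ * ⟨g.1, hGK g.2⟩, rfl⟩
  have hbij : Function.Bijective fun z => (⟨ψ z, hmem z⟩ : MulAction.orbit K t₀) := by
    constructor
    · rintro ⟨x, y⟩ ⟨x', y'⟩ h
      have h : ψ (x, y) = ψ (x', y') := congrArg Subtype.val h
      obtain ⟨k, rfl⟩ := exists_smul_eq y
      obtain ⟨k', rfl⟩ := exists_smul_eq y'
      rw [hψ, hψ] at h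
      have h1 : k⁻¹ • k • (x : I) ∈ J := by
        rw [inv_smul_smul]
        exact hX x
      have h2 : k'⁻¹ • k • (x : I) ∈ J := by
        rw [h, inv_smul_smul]
        exact hX x'
      rw [hw.eqOn_of_mem h1 h2 _ (hX x')] at h
      have hx : x = x' := Subtype.ext (smul_left_cancel k h)
      have hy : k' • J = k • J := hw.smul_eq_of_mem h1 h2
      simp only [hx, hy]
    · rintro ⟨_, a, rfl⟩
      obtain ⟨w, rfl⟩ := Φ.surjective a
      let z : MulAction.orbit G t₀ × MulAction.orbit H J :=
        (⟨t₀, MulAction.mem_orbit_self t₀⟩, ⟨(1 : H) • J, MulAction.mem_orbit J 1⟩)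
      have hz : ψ z = t₀ := by
        rw [hψ, one_smul]
      refine ⟨w • z, Subtype.ext ?_⟩
      change ψ (w • z) = Φ w • t₀
      rw [hequi, hz]
  exact ⟨Φ, Equiv.ofBijective _ hbij, hψ, fun w z => Subtype.ext (hequi w z)⟩

end WreathPair

end OscGroups

namespace OscGroups

/-! ### Orbitals of a homeomorphism -/

section Orbitals

variable {f : I ≃o I} {p q : I × I}

lemma not_mem_supp_iff {t : I} : t ∉ supp f ↔ f t = t := not_not

lemma fst_not_mem_Ioo (hp : p ∈ orbitals f) (hq : q ∈ orbitals f) : p.1 ∉ Ioo q.1 q.2 :=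
  fun h => hq.2.2.2 h hp.2.1

lemma snd_not_mem_Ioo (hp : p ∈ orbitals f) (hq : q ∈ orbitals f) : p.2 ∉ Ioo q.1 q.2 :=
  fun h => hq.2.2.2 h hp.2.2.1

lemma orbital_eq (hp : p ∈ orbitals f) (hq : q ∈ orbitals f) {x : I} (hx : x ∈ Ioo p.1 p.2)
    (hx' : x ∈ Ioo q.1 q.2) : p = q := by
  have h1 := fst_not_mem_Ioo hp hq
  have h2 := fst_not_mem_Ioo hq hp
  have h3 := snd_not_mem_Ioo hp hq
  have h4 := snd_not_mem_Ioo hq hp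
  simp only [mem_Ioo, not_and, not_lt] at h1 h2 h3 h4 hx hx'
  refine Prod.ext (le_antisymm ?_ ?_) (le_antisymm ?_ ?_)
  · by_contra! h
    exact absurd (h1 h) (not_le.2 (hx.1.trans hx'.2))
  · by_contra! h
    exact absurd (h2 h) (not_le.2 (hx'.1.trans hx.2))
  · by_contra! h
    exact absurd (h4 (hx.1.trans hx'.2)) (not_le.2 h)
  · by_contra! h
    exact absurd (h3 (hx'.1.trans hx.2)) (not_le.2 h)

lemma snd_le_fst_or (hp : p ∈ orbitals f) (hq : q ∈ orbitals f) (h : p ≠ q) :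
    p.2 ≤ q.1 ∨ q.2 ≤ p.1 := by
  by_contra! hc
  obtain ⟨x, hx, hx'⟩ := exists_between (max_lt (lt_min hp.1 hc.2) (lt_min hc.1 hq.1) :
    max p.1 q.1 < min p.2 q.2)
  rw [max_lt_iff] at hx
  rw [lt_min_iff] at hx'
  exact h (orbital_eq hp hq ⟨hx.1, hx'.1⟩ ⟨hx.2, hx'.2⟩)

/-- The ends are the supremum of the fixed points below `x` and the infimum of those above; both are
fixed, since `f` commutes with suprema and infima. -/
lemma exists_orbital {x : I} (hx : x ∈ supp f) : ∃ p ∈ orbitals f, x ∈ Ioo p.1 p.2 := by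
  set S : Set I := {t | f t = t ∧ t ≤ x}
  set T : Set I := {t | f t = t ∧ x ≤ t}
  have hS : f (sSup S) = sSup S := by
    rw [f.map_sSup, sSup_eq_iSup]
    exact iSup_congr fun t => iSup_congr fun ht => ht.1
  have hT : f (sInf T) = sInf T := by
    rw [f.map_sInf, sInf_eq_iInf]
    exact iInf_congr fun t => iInf_congr fun ht => ht.1
  have h1 : sSup S < x := by
    refine lt_of_le_of_ne (sSup_le fun t ht => ht.2) fun e => hx ?_
    rw [← e, hS]
  have h2 : x < sInf T := by
    refine lt_of_le_of_ne (le_sInf fun t ht => ht.2) fun e => hx ?_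
    rw [e, hT]
  refine ⟨(sSup S, sInf T), ⟨h1.trans h2, hS, hT, fun t ht hft => ?_⟩, h1, h2⟩
  rcases le_total t x with h | h
  · exact absurd (le_sSup (show t ∈ S from ⟨hft, h⟩)) (not_le.2 ht.1)
  · exact absurd (sInf_le (show t ∈ T from ⟨hft, h⟩)) (not_le.2 ht.2)

lemma lt_apply_or_apply_lt (hp : p ∈ orbitals f) :
    (∀ t ∈ Ioo p.1 p.2, t < f t) ∨ ∀ t ∈ Ioo p.1 p.2, f t < t := by
  by_contra! h
  obtain ⟨⟨a, ha, hfa⟩, b, hb, hfb⟩ := h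
  obtain ⟨x, hx, hfx⟩ := isPreconnected_Ioo.intermediate_value₂ ha hb f.continuous.continuousOn
    continuousOn_id hfa hfb
  exact hp.2.2.2 hx hfx

lemma zpow_apply_mem_Ioo (hp : p ∈ orbitals f) {t : I} (ht : t ∈ Ioo p.1 p.2) (n : ℤ) :
    (f ^ n) t ∈ Ioo p.1 p.2 := by
  constructor
  · conv_lhs => rw [← zpow_apply_eq_self hp.2.1 n]
    exact (OrderIso.lt_iff_lt _).2 ht.1
  · conv_rhs => rw [← zpow_apply_eq_self hp.2.2.1 n]
    exact (OrderIso.lt_iff_lt _).2 ht.2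

/-- The infimum of a full orbit is a fixed point in `[u, v)`, hence equals `u`. Using all integer
powers avoids distinguishing positive from negative bumps. -/
lemma exists_zpow_apply_lt (hp : p ∈ orbitals f) {t : I} (ht : t ∈ Ioo p.1 p.2) {y : I}
    (hy : p.1 < y) : ∃ n : ℤ, (f ^ n) t ∈ Ioo p.1 p.2 ∧ (f ^ n) t < y := by
  have hfix : f (⨅ n : ℤ, (f ^ n) t) = ⨅ n : ℤ, (f ^ n) t := by
    rw [f.map_iInf]
    conv_rhs => rw [← (Equiv.addLeft (1 : ℤ)).iInf_comp]
    refine iInf_congr fun n => ?_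
    rw [Equiv.coe_addLeft, zpow_add, zpow_one, RelIso.mul_apply]
  have h1 : p.1 ≤ ⨅ n : ℤ, (f ^ n) t := le_iInf fun n => (zpow_apply_mem_Ioo hp ht n).1.le
  have h2 : ⨅ n : ℤ, (f ^ n) t < p.2 := (iInf_le _ 0).trans_lt (by simpa using ht.2)
  have h3 : ⨅ n : ℤ, (f ^ n) t = p.1 := by
    by_contra h
    exact hp.2.2.2 ⟨lt_of_le_of_ne h1 (Ne.symm h), h2⟩ hfix
  rw [← h3, iInf_lt_iff] at hy
  obtain ⟨n, hn⟩ := hy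
  exact ⟨n, zpow_apply_mem_Ioo hp ht n, hn⟩

lemma exists_lt_zpow_apply (hp : p ∈ orbitals f) {t : I} (ht : t ∈ Ioo p.1 p.2) {y : I}
    (hy : y < p.2) : ∃ n : ℤ, (f ^ n) t ∈ Ioo p.1 p.2 ∧ y < (f ^ n) t := by
  have hfix : f (⨆ n : ℤ, (f ^ n) t) = ⨆ n : ℤ, (f ^ n) t := by
    rw [f.map_iSup]
    conv_rhs => rw [← (Equiv.addLeft (1 : ℤ)).iSup_comp]
    refine iSup_congr fun n => ?_
    rw [Equiv.coe_addLeft, zpow_add, zpow_one, RelIso.mul_apply]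
  have h1 : ⨆ n : ℤ, (f ^ n) t ≤ p.2 := iSup_le fun n => (zpow_apply_mem_Ioo hp ht n).2.le
  have h2 : p.1 < ⨆ n : ℤ, (f ^ n) t :=
    lt_of_lt_of_le (by simpa using ht.1) (le_iSup (fun n : ℤ => (f ^ n) t) 0)
  have h3 : ⨆ n : ℤ, (f ^ n) t = p.2 := by
    by_contra h
    exact hp.2.2.2 ⟨h2, lt_of_le_of_ne h1 h⟩ hfix
  rw [← h3, lt_iSup_iff] at hy
  obtain ⟨n, hn⟩ := hy
  exact ⟨n, zpow_apply_mem_Ioo hp ht n, hn⟩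

lemma IsLeftmost.eq (hp : IsLeftmost f p) (hq : IsLeftmost f q) : p = q := by
  by_contra h
  rcases snd_le_fst_or hp.1 hq.1 h with h' | h'
  · exact absurd (h'.trans (hq.2 p hp.1)) (not_le.2 hp.1.1)
  · exact absurd (h'.trans (hp.2 q hq.1)) (not_le.2 hq.1.1)

lemma IsRightmost.eq (hp : IsRightmost f p) (hq : IsRightmost f q) : p = q := by
  by_contra h
  rcases snd_le_fst_or hp.1 hq.1 h with h' | h'
  · exact absurd ((hp.2 q hq.1).trans h') (not_le.2 hq.1.1)
  · exact absurd ((hq.2 p hp.1).trans h') (not_le.2 hp.1.1)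

lemma IsLeftmost.snd_le (hp : IsLeftmost f p) (hq : q ∈ orbitals f) (h : q ≠ p) :
    p.2 ≤ q.1 := by
  rcases snd_le_fst_or hp.1 hq h.symm with h' | h'
  · exact h'
  · exact absurd (h'.trans (hp.2 q hq)) (not_le.2 hq.1)

lemma IsRightmost.le_fst (hp : IsRightmost f p) (hq : q ∈ orbitals f) (h : q ≠ p) :
    q.2 ≤ p.1 := by
  rcases snd_le_fst_or hp.1 hq h.symm with h' | h'
  · exact absurd ((hp.2 q hq).trans h') (not_le.2 hq.1)
  · exact h'

end Orbitals

namespace MarkedFunction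

/-! ### Feet of bumps -/

section Feet

variable (f : MarkedFunction) (p : orbitals f.toHomeo)

lemma endMarker_cases :
    ((∀ t ∈ Ioo p.1.1 p.1.2, t < f.toHomeo t) ∧ f.toHomeo (f.marker p) = f.endMarker p) ∨
    ((∀ t ∈ Ioo p.1.1 p.1.2, f.toHomeo t < t) ∧ f.toHomeo (f.endMarker p) = f.marker p) := by
  rcases lt_apply_or_apply_lt p.2 with h | h
  · exact Or.inl ⟨h, by rw [endMarker, if_pos (h _ (f.marker_mem p))]⟩
  · refine Or.inr ⟨h, ?_⟩
    rw [endMarker, if_neg (h _ (f.marker_mem p)).not_gt]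
    exact f.toHomeo.apply_symm_apply _

lemma marker_lt_endMarker : f.marker p < f.endMarker p := by
  rcases f.endMarker_cases p with ⟨h, e⟩ | ⟨h, e⟩
  · rw [← e]
    exact h _ (f.marker_mem p)
  · have := f.marker_mem p
    rw [← e] at this ⊢
    refine h _ ⟨?_, ?_⟩
    · rw [← f.toHomeo.lt_iff_lt, p.2.2.1]
      exact this.1
    · rw [← f.toHomeo.lt_iff_lt, p.2.2.2.1]
      exact this.2

lemma endMarker_lt : f.endMarker p < p.1.2 := by
  rcases f.endMarker_cases p with ⟨h, e⟩ | ⟨h, e⟩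
  · rw [← e, ← p.2.2.2.1]
    exact f.toHomeo.lt_iff_lt.2 (f.marker_mem p).2
  · rw [← f.toHomeo.lt_iff_lt, e, p.2.2.2.1]
    exact (f.marker_mem p).2

/-- The left foot of a bump together with its left endpoint. -/
def leftFoot : Set I := Ico p.1.1 (f.marker p)

/-- The right foot of a bump. -/
def rightFoot : Set I := Ico (f.endMarker p) p.1.2

variable {f p}

lemma leftFoot_subset : f.leftFoot p ⊆ Ico p.1.1 p.1.2 :=
  Ico_subset_Ico_right (f.marker_mem p).2.le

lemma rightFoot_subset : f.rightFoot p ⊆ Ico p.1.1 p.1.2 :=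
  Ico_subset_Ico_left ((f.marker_mem p).1.trans (f.marker_lt_endMarker p)).le

lemma disjoint_leftFoot_rightFoot : Disjoint (f.leftFoot p) (f.rightFoot p) :=
  Set.disjoint_left.2 fun _ h h' => absurd (h.2.trans (f.marker_lt_endMarker p)) (not_lt.2 h'.1)

lemma exists_Ioo_subset_bumpFeet {x : I} (h : x ∈ f.leftFoot p ∪ f.rightFoot p) :
    ∃ y, x < y ∧ Ioo x y ⊆ f.bumpFeet p := by
  rcases h with h | h
  · exact ⟨_, h.2, fun t ht => Or.inl ⟨h.1.trans_lt ht.1, ht.2⟩⟩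
  · exact ⟨_, h.2, fun t ht => Or.inr ⟨h.1.trans ht.1.le, ht.2⟩⟩

/-- Left feet are taken closed on the left here, unlike in `bumpFeet`. Disjointness survives,
because a common point of two half-open feet has common interior points immediately to its right. -/
lemma IsFast.eq_of_mem {S : Set MarkedFunction} (hS : IsFast S) {g : MarkedFunction}
    (hf : f ∈ S) (hg : g ∈ S) {q : orbitals g.toHomeo} {x : I}
    (hx : x ∈ f.leftFoot p ∪ f.rightFoot p) (hx' : x ∈ g.leftFoot q ∪ g.rightFoot q) :
    f = g ∧ p.1 = q.1 := by
  by_contra h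
  obtain ⟨y, hy, hyp⟩ := exists_Ioo_subset_bumpFeet hx
  obtain ⟨z, hz, hzq⟩ := exists_Ioo_subset_bumpFeet hx'
  obtain ⟨t, ht, ht'⟩ := exists_between (lt_min hy hz)
  rw [lt_min_iff] at ht'
  exact Set.disjoint_left.1 (hS f hf g hg p q h) (hyp ⟨ht, ht'.1⟩) (hzq ⟨ht, ht'.2⟩)

/-- Orbitals with the same left end would have overlapping left feet. -/
lemma IsFast.fst_ne {S : Set MarkedFunction} (hS : IsFast S) {g : MarkedFunction}
    (hf : f ∈ S) (hg : g ∈ S) (hfg : f ≠ g) {p q : I × I} (hp : p ∈ orbitals f.toHomeo)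
    (hq : q ∈ orbitals g.toHomeo) : p.1 ≠ q.1 := by
  intro e
  have h1 := f.marker_mem ⟨p, hp⟩
  have h2 := g.marker_mem ⟨q, hq⟩
  exact hfg (hS.eq_of_mem hf hg (p := ⟨p, hp⟩) (q := ⟨q, hq⟩) (x := p.1)
    (Or.inl ⟨le_rfl, h1.1⟩) (Or.inl ⟨e.ge, e ▸ h2.1⟩)).1

lemma IsFast.snd_ne {S : Set MarkedFunction} (hS : IsFast S) {g : MarkedFunction}
    (hf : f ∈ S) (hg : g ∈ S) (hfg : f ≠ g) {p q : I × I} (hp : p ∈ orbitals f.toHomeo)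
    (hq : q ∈ orbitals g.toHomeo) : p.2 ≠ q.2 := by
  intro e
  have h1 := f.endMarker_lt ⟨p, hp⟩
  have h2 := g.endMarker_lt ⟨q, hq⟩
  dsimp only at h1 h2
  refine hfg (hS.eq_of_mem hf hg (p := ⟨p, hp⟩) (q := ⟨q, hq⟩)
    (x := max (f.endMarker ⟨p, hp⟩) (g.endMarker ⟨q, hq⟩))
    (Or.inr ⟨le_max_left _ _, max_lt h1 ?_⟩) (Or.inr ⟨le_max_right _ _, max_lt ?_ h2⟩)).1
  · exact e ▸ h2
  · exact e ▸ h1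

/-- The foot of a bump into which `f` (if `b` is true) or its inverse pushes. -/
def target (f : MarkedFunction) (p : orbitals f.toHomeo) (b : Bool) : Set I :=
  {x | (x ∈ f.rightFoot p ∧ (f.marker p < f.toHomeo (f.marker p) ↔ b = true)) ∨
    (x ∈ f.leftFoot p ∧ (f.marker p < f.toHomeo (f.marker p) ↔ b = false))}

/-- `f` if `b` is true and its inverse otherwise. -/
def signed (f : MarkedFunction) (b : Bool) : I ≃o I := if b then f.toHomeo else f.toHomeo⁻¹

lemma signed_not (f : MarkedFunction) (b : Bool) : f.signed (!b) = (f.signed b)⁻¹ := by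
  cases b <;> simp [signed]

lemma mem_feet_of_mem_target {b : Bool} {x : I} (h : x ∈ f.target p b) :
    x ∈ f.leftFoot p ∪ f.rightFoot p :=
  h.elim (fun h => Or.inr h.1) fun h => Or.inl h.1

lemma exists_mem_target {x : I} (h : x ∈ f.leftFoot p ∪ f.rightFoot p) :
    ∃ b, x ∈ f.target p b := by
  by_cases e : f.marker p < f.toHomeo (f.marker p)
  · rcases h with h | h
    · exact ⟨false, Or.inr ⟨h, by simp [e]⟩⟩
    · exact ⟨true, Or.inl ⟨h, by simp [e]⟩⟩
  · rcases h with h | h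
    · exact ⟨true, Or.inr ⟨h, by simp [e]⟩⟩
    · exact ⟨false, Or.inl ⟨h, by simp [e]⟩⟩

lemma target_eq (b : Bool) :
    (f.target p b = f.leftFoot p ∧ f.target p (!b) = f.rightFoot p ∧
      f.signed b (f.endMarker p) = f.marker p) ∨
    (f.target p b = f.rightFoot p ∧ f.target p (!b) = f.leftFoot p ∧
      f.signed b (f.marker p) = f.endMarker p) := by
  have hm := f.marker_mem p
  rcases f.endMarker_cases p with ⟨h, e⟩ | ⟨h, e⟩
  · have hlt := h _ hm
    cases b
    · left
      refine ⟨?_, ?_, ?_⟩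
      · ext; simp [target, hlt]
      · ext; simp [target, hlt]
      · rw [← e]
        exact orderIso_inv_apply_self _ _
    · right
      refine ⟨?_, ?_, by simpa [signed] using e⟩
      · ext; simp [target, hlt]
      · ext; simp [target, hlt]
  · have hlt := (h _ hm).not_gt
    cases b
    · right
      refine ⟨?_, ?_, ?_⟩
      · ext; simp [target, hlt]
      · ext; simp [target, hlt]
      · rw [← e]
        exact orderIso_inv_apply_self _ _
    · left
      refine ⟨?_, ?_, by simpa [signed] using e⟩
      · ext; simp [target, hlt]
      · ext; simp [target, hlt]

lemma disjoint_target (b : Bool) : Disjoint (f.target p b) (f.target p (!b)) := by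
  rcases target_eq (f := f) (p := p) b with ⟨h1, h2, -⟩ | ⟨h1, h2, -⟩
  · rw [h1, h2]
    exact disjoint_leftFoot_rightFoot
  · rw [h1, h2]
    exact disjoint_leftFoot_rightFoot.symm

lemma signed_fst (b : Bool) : f.signed b p.1.1 = p.1.1 := by
  cases b
  · change f.toHomeo⁻¹ p.1.1 = _
    conv_lhs => rw [← p.2.2.1]
    exact orderIso_inv_apply_self _ _
  · exact p.2.2.1

lemma signed_snd (b : Bool) : f.signed b p.1.2 = p.1.2 := by
  cases b
  · change f.toHomeo⁻¹ p.1.2 = _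
    conv_lhs => rw [← p.2.2.2.1]
    exact orderIso_inv_apply_self _ _
  · exact p.2.2.2.1

lemma signed_mem_Ico {b : Bool} {x : I} (hx : x ∈ Ico p.1.1 p.1.2) :
    f.signed b x ∈ Ico p.1.1 p.1.2 := by
  have h1 := signed_fst (f := f) (p := p) b
  have h2 := signed_snd (f := f) (p := p) b
  constructor
  · rw [← h1]
    exact (OrderIso.le_iff_le _).2 hx.1
  · rw [← h2]
    exact (OrderIso.lt_iff_lt _).2 hx.2

lemma signed_mem_target {b : Bool} {x : I} (hx : x ∈ Ico p.1.1 p.1.2)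
    (hx' : x ∉ f.target p (!b)) : f.signed b x ∈ f.target p b := by
  have hI := signed_mem_Ico (b := b) hx
  rcases target_eq (f := f) (p := p) b with ⟨h1, h2, h3⟩ | ⟨h1, h2, h3⟩
  · rw [h2] at hx'
    rw [h1]
    refine ⟨hI.1, ?_⟩
    rw [← h3, OrderIso.lt_iff_lt]
    by_contra! h
    exact hx' ⟨h, hx.2⟩
  · rw [h2] at hx'
    rw [h1]
    refine ⟨?_, hI.2⟩
    rw [← h3, OrderIso.le_iff_le]
    by_contra! h
    exact hx' ⟨hx.1, h⟩

lemma signed_not_mem_target {b : Bool} {x : I} (hx : x ∈ f.target p b) :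
    f.signed (!b) x ∉ f.target p (!b) := by
  have hI : f.signed b (f.signed (!b) x) = x := by
    rw [signed_not]
    exact orderIso_apply_inv_self _ _
  intro hc
  rcases target_eq (f := f) (p := p) b with ⟨h1, h2, h3⟩ | ⟨h1, h2, h3⟩
  · rw [h2] at hc
    rw [h1, ← hI] at hx
    have := hx.2
    rw [← h3, OrderIso.lt_iff_lt] at this
    exact absurd this (not_lt.2 hc.1)
  · rw [h2] at hc
    rw [h1, ← hI] at hx
    have := hx.1
    rw [← h3, OrderIso.le_iff_le] at this
    exact absurd hc.2 (not_lt.2 this)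

end Feet

/-! ### The ping-pong system of a fast set -/

lemma eq_not_of_ne {b c : Bool} (h : c ≠ b) : c = !b := by
  revert b c
  decide

/-- The ping-pong system given by a fast set of marked functions. -/
noncomputable def pingPong (S : Set MarkedFunction) (hS : IsFast S) : PingPong (S × Bool) I where
  act a := a.1.1.signed a.2
  inv a := (a.1, !a.2)
  moved a := ⋃ p : orbitals a.1.1.toHomeo, Ico p.1.1 p.1.2
  foot a := ⋃ p : orbitals a.1.1.toHomeo, a.1.1.target p a.2
  inv_inv a := by simp
  act_inv a := a.1.1.signed_not a.2
  foot_disjoint := by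
    rintro ⟨f, b⟩ ⟨g, c⟩ hab
    rw [Set.disjoint_left]
    intro x hx hx'
    obtain ⟨p, hp⟩ := mem_iUnion.1 hx
    obtain ⟨q, hq⟩ := mem_iUnion.1 hx'
    obtain ⟨h1, h2⟩ := hS.eq_of_mem f.2 g.2 (mem_feet_of_mem_target hp)
      (mem_feet_of_mem_target hq)
    obtain rfl := Subtype.ext h1
    obtain rfl := Subtype.ext h2
    obtain rfl := eq_not_of_ne fun e : c = b => hab (by rw [e])
    exact Set.disjoint_left.1 (disjoint_target b) hp hq
  foot_subset a := iUnion_mono fun p x hx => (mem_feet_of_mem_target hx).elim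
    (fun h => leftFoot_subset h) fun h => rightFoot_subset h
  fix := by
    rintro ⟨f, b⟩ x hx
    have hfx : f.1.toHomeo x = x := by
      by_contra h
      obtain ⟨p, hp, hxp⟩ := exists_orbital h
      exact hx (mem_iUnion.2 ⟨⟨p, hp⟩, hxp.1.le, hxp.2⟩)
    cases b
    · change f.1.toHomeo⁻¹ x = x
      conv_lhs => rw [← hfx]
      exact orderIso_inv_apply_self _ _
    · exact hfx
  maps := by
    rintro ⟨f, b⟩ x hx hx'
    obtain ⟨p, hp⟩ := mem_iUnion.1 hx
    exact mem_iUnion.2 ⟨p, signed_mem_target hp fun h => hx' (mem_iUnion.2 ⟨p, h⟩)⟩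
  back := by
    rintro ⟨f, b⟩ x hx
    obtain ⟨p, hp⟩ := mem_iUnion.1 hx
    have hI : x ∈ Ico p.1.1 p.1.2 := (mem_feet_of_mem_target hp).elim
      (fun h => leftFoot_subset h) fun h => rightFoot_subset h
    have hI' := signed_mem_Ico (b := !b) hI
    refine ⟨mem_iUnion.2 ⟨p, hI'⟩, fun h => ?_⟩
    obtain ⟨q, hq⟩ := mem_iUnion.1 h
    have hq' : f.1.signed (!b) x ∈ Ico q.1.1 q.1.2 := (mem_feet_of_mem_target hq).elim
      (fun h => leftFoot_subset h) fun h => rightFoot_subset h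
    have hpq : p = q := by
      by_contra hne
      rcases snd_le_fst_or p.2 q.2 (fun e => hne (Subtype.ext e)) with h' | h'
      · exact absurd (hI'.2.trans_le h') (not_lt.2 hq'.1)
      · exact absurd (hq'.2.trans_le h') (not_lt.2 hI'.1)
    subst hpq
    exact signed_not_mem_target hp hq
  dichotomy := by
    rintro ⟨f, b⟩ K hK h1 h2
    have hfeet : ∀ p : orbitals f.1.toHomeo, ∀ x ∈ K, x ∉ f.1.leftFoot p ∪ f.1.rightFoot p := by
      intro p x hx hxp
      obtain ⟨c, hc⟩ := exists_mem_target hxp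
      by_cases e : c = b
      · subst e
        exact Set.disjoint_left.1 h1 hx (mem_iUnion.2 ⟨p, hc⟩)
      · have e' : c = !b := eq_not_of_ne e
        subst e'
        exact Set.disjoint_left.1 h2 hx (mem_iUnion.2 ⟨p, hc⟩)
    rw [or_iff_not_imp_right, Set.not_disjoint_iff]
    rintro ⟨x, hx, hxp⟩ y hy
    obtain ⟨p, hp⟩ := mem_iUnion.1 hxp
    refine mem_iUnion.2 ⟨p, ?_⟩
    have hm := f.1.marker_mem p
    -- An interval that leaves `[u, v)` contains `u`, which is in the left foot, or a point of the
    -- right foot close to `v`; the maximum below picks one to the right of `x`.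
    by_contra hyp
    rw [mem_Ico, not_and_or, not_le, not_lt] at hyp
    rcases hyp with h | h
    · exact hfeet p p.1.1 (hK.out hy hx ⟨h.le, hp.1⟩) (Or.inl ⟨le_rfl, hm.1⟩)
    · have h3 := f.1.endMarker_lt p
      exact hfeet p (max x (f.1.endMarker p))
        (hK.out hx hy ⟨le_max_left _ _, max_le hp.2.le h3.le |>.trans h⟩)
        (Or.inr ⟨le_max_right _ _, max_lt hp.2 h3⟩)

lemma pingPong_group {S : Set MarkedFunction} (hS : IsFast S) :
    (pingPong S hS).group = gen S := by
  apply le_antisymm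
  · rw [PingPong.group, Subgroup.closure_le]
    rintro _ ⟨⟨f, b⟩, rfl⟩
    have hf : f.1.toHomeo ∈ gen S := Subgroup.subset_closure ⟨f.1, f.2, rfl⟩
    cases b
    · exact inv_mem hf
    · exact hf
  · rw [gen, Subgroup.closure_le]
    rintro _ ⟨f, hf, rfl⟩
    exact Subgroup.subset_closure ⟨(⟨f, hf⟩, true), rfl⟩

lemma mem_foot_pingPong {S : Set MarkedFunction} {hS : IsFast S} {a : S × Bool} {x : I} :
    x ∈ (pingPong S hS).foot a ↔ ∃ p, x ∈ a.1.1.target p a.2 := mem_iUnion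

lemma exists_disjoint_Ico {T : Set (I × I)} (hT : T.Finite) {x z : I} (hz : x < z)
    (h : ∀ p ∈ T, x ∉ Ico p.1 p.2) :
    ∃ y, x < y ∧ ∀ p ∈ T, Disjoint (Ico x y) (Ico p.1 p.2) := by
  induction T, hT using Set.Finite.induction_on with
  | empty => exact ⟨z, hz, by simp⟩
  | @insert p T _ _ ih =>
    obtain ⟨y, hy, hyT⟩ := ih fun q hq => h q (mem_insert_of_mem _ hq)
    have hp := h p (mem_insert _ _)
    by_cases hxp : x < p.1
    · refine ⟨min y p.1, lt_min hy hxp, ?_⟩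
      rintro q (rfl | hq)
      · exact Set.disjoint_left.2 fun t ht ht' =>
          absurd (ht.2.trans_le (min_le_right _ _)) (not_lt.2 ht'.1)
      · exact (hyT q hq).mono_left (Ico_subset_Ico_right (min_le_left _ _))
    · refine ⟨y, hy, ?_⟩
      rintro q (rfl | hq)
      · have : q.2 ≤ x := by
          by_contra! h'
          exact hp ⟨not_lt.1 hxp, h'⟩
        exact Set.disjoint_left.2 fun t ht ht' =>
          absurd (ht'.2.trans_le this) (not_lt.2 ht.1)
      · exact hyT q hq

lemma exists_Ico_disjoint_foot {S : Set MarkedFunction} (hS : IsFast S) (hfin : S.Finite)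
    (horb : ∀ f ∈ S, (orbitals f.toHomeo).Finite) (x z : I) (hz : x < z)
    (hx : ∀ a, x ∉ (pingPong S hS).foot a) :
    ∃ y, x < y ∧ ∀ a, Disjoint (Ico x y) ((pingPong S hS).foot a) := by
  have hx' : ∀ (f : S) (p : orbitals f.1.toHomeo), x ∉ f.1.leftFoot p ∪ f.1.rightFoot p := by
    intro f p h
    obtain ⟨b, hb⟩ := exists_mem_target h
    exact hx (f, b) (mem_foot_pingPong.2 ⟨p, hb⟩)
  have hS' : Finite S := hfin
  have ho : ∀ f : S, Finite (orbitals f.1.toHomeo) := fun f => horb f.1 f.2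
  let T : Set (I × I) := ⋃ f : S, ⋃ p : orbitals f.1.toHomeo,
    {(p.1.1, f.1.marker p), (f.1.endMarker p, p.1.2)}
  have hT : T.Finite := Set.finite_iUnion fun f => Set.finite_iUnion fun p => by simp
  obtain ⟨y, hy, hyT⟩ := exists_disjoint_Ico hT hz (by
    intro q hq
    simp only [T, mem_iUnion] at hq
    obtain ⟨f, p, rfl | rfl⟩ := hq
    · exact fun h => hx' f p (Or.inl h)
    · exact fun h => hx' f p (Or.inr h))
  refine ⟨y, hy, fun a => Set.disjoint_left.2 fun t ht hta => ?_⟩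
  obtain ⟨p, hp⟩ := mem_foot_pingPong.1 hta
  rcases mem_feet_of_mem_target hp with h | h
  · refine Set.disjoint_left.1 (hyT (p.1.1, a.1.1.marker p) ?_) ht h
    exact mem_iUnion₂.2 ⟨a.1, p, by simp⟩
  · refine Set.disjoint_left.1 (hyT (a.1.1.endMarker p, p.1.2) ?_) ht h
    exact mem_iUnion₂.2 ⟨a.1, p, by simp⟩

end MarkedFunction

end OscGroups

namespace OscGroups
namespace MarkedFunction

/-! ### Extended supports -/

section ExtSupp

variable {f : I ≃o I}

lemma Ioo_subset_extSupp {p : I × I} (hp : p ∈ orbitals f) :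
    Ioo (p.1 : ℝ) p.2 ⊆ extSupp f := by
  refine interior_maximal (Subset.trans ?_ subset_closure) isOpen_Ioo
  intro x hx
  exact ⟨⟨x, p.1.2.1.trans hx.1.le, hx.2.le.trans p.2.2.2⟩, hp.2.2.2 ⟨hx.1, hx.2⟩, rfl⟩

lemma extSupp_subset {L R : I × I} (hL : IsLeftmost f L) (hR : IsRightmost f R) :
    extSupp f ⊆ Ioo (L.1 : ℝ) R.2 := by
  rw [← interior_Icc]
  refine interior_mono (closure_minimal ?_ isClosed_Icc)
  rintro _ ⟨t, ht, rfl⟩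
  obtain ⟨p, hp, htp⟩ := exists_orbital ht
  exact ⟨(hL.2 p hp).trans htp.1.le, htp.2.le.trans (hR.2 p hp)⟩

lemma Icc_subset_closure_extSupp {p : I × I} (hp : p ∈ orbitals f) :
    Icc (p.1 : ℝ) p.2 ⊆ closure (extSupp f) := by
  have h : (p.1 : ℝ) < p.2 := hp.1
  rw [← closure_Ioo h.ne]
  exact closure_mono (Ioo_subset_extSupp hp)

lemma exists_mem_supp_Ioo {a b : I} (hab : a < b) (h : Ioo (a : ℝ) b ⊆ extSupp f) :
    ∃ t ∈ supp f, t ∈ Ioo a b := by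
  obtain ⟨z, hz⟩ := exists_between hab
  have hz' : (z : ℝ) ∈ closure ((↑) '' supp f) := interior_subset (h hz)
  obtain ⟨_, ht, t, hts, rfl⟩ := mem_closure_iff.1 hz' (Ioo (a : ℝ) b) isOpen_Ioo hz
  exact ⟨t, hts, ht⟩

end ExtSupp

/-! ### Standard functions and standard pairs -/

section Standard

variable {f g : MarkedFunction}

lemma IsStandard.exists_leftmost_rightmost (hf : f.IsStandard) :
    ∃ L R, IsLeftmost f.toHomeo L ∧ IsRightmost f.toHomeo R := by
  have hne : (orbitals f.toHomeo).Nonempty := by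
    by_contra! h
    have hs : supp f.toHomeo = ∅ := by
      by_contra hs
      obtain ⟨t, ht⟩ := nonempty_iff_ne_empty.2 hs
      obtain ⟨p, hp, -⟩ := exists_orbital ht
      exact h.subset hp
    have := hf.extSupp_nonempty
    simp [extSupp, hs] at this
  obtain ⟨L, hL, hL'⟩ := Set.exists_min_image _ Prod.fst hf.finite_orbitals hne
  obtain ⟨R, hR, hR'⟩ := Set.exists_max_image _ Prod.snd hf.finite_orbitals hne
  exact ⟨L, R, ⟨hL, hL'⟩, hR, hR'⟩

lemma IsStandard.Ioo_subset_extSupp (hf : f.IsStandard) {L R : I × I}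
    (hL : IsLeftmost f.toHomeo L) (hR : IsRightmost f.toHomeo R) :
    Ioo (L.1 : ℝ) R.2 ⊆ extSupp f.toHomeo := by
  intro x hx
  have h1 : (L.1 : ℝ) < L.2 := hL.1.1
  have h2 : (R.1 : ℝ) < R.2 := hR.1.1
  obtain ⟨a, ha, ha'⟩ := exists_between (lt_min hx.1 h1)
  obtain ⟨b, hb, hb'⟩ := exists_between (max_lt hx.2 h2)
  rw [lt_min_iff] at ha'
  rw [max_lt_iff] at hb
  exact hf.extSupp_interval.out (MarkedFunction.Ioo_subset_extSupp hL.1 ⟨ha, ha'.2⟩)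
    (MarkedFunction.Ioo_subset_extSupp hR.1 ⟨hb.2, hb'⟩) ⟨ha'.1.le, hb.1.le⟩

/-- The orbitals of a standard function are adjacent to each other. -/
lemma IsStandard.mem_orbital_or (hf : f.IsStandard) {L R : I × I}
    (hL : IsLeftmost f.toHomeo L) (hR : IsRightmost f.toHomeo R) {x : I} (hx : x ∈ Ioo L.1 R.2) :
    (∃ p ∈ orbitals f.toHomeo, x ∈ Ioo p.1 p.2) ∨
      (∃ p ∈ orbitals f.toHomeo, p.2 = x) ∧ ∃ p ∈ orbitals f.toHomeo, p.1 = x := by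
  rw [or_iff_not_imp_left]
  intro hxo
  push Not at hxo
  have hsub := hf.Ioo_subset_extSupp hL hR
  constructor
  -- Take the last orbital that ends by `x`. A gap between it and `x` would lie in the extended
  -- support, hence contain support points and a later orbital.
  · obtain ⟨m, hm, hm'⟩ := Set.exists_max_image {p ∈ orbitals f.toHomeo | p.2 ≤ x} Prod.snd
      (hf.finite_orbitals.subset (sep_subset _ _))
      ⟨L, hL.1, by
        by_contra! h
        exact hxo L hL.1 ⟨hx.1, h⟩⟩
    refine ⟨m, hm.1, le_antisymm hm.2 ?_⟩
    by_contra! h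
    obtain ⟨t, ht, htm⟩ := exists_mem_supp_Ioo (f := f.toHomeo) h fun z hz =>
      hsub ⟨lt_of_le_of_lt ((hL.2 m hm.1).trans hm.1.1.le) hz.1, hz.2.trans hx.2⟩
    obtain ⟨p, hp, htp⟩ := exists_orbital ht
    have hpx : p.2 ≤ x := by
      by_contra! h'
      exact hxo p hp ⟨htp.1.trans htm.2, h'⟩
    exact absurd (htm.1.trans htp.2) (not_lt.2 (hm' p ⟨hp, hpx⟩))
  · obtain ⟨m, hm, hm'⟩ := Set.exists_min_image {p ∈ orbitals f.toHomeo | x ≤ p.1} Prod.fst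
      (hf.finite_orbitals.subset (sep_subset _ _))
      ⟨R, hR.1, by
        by_contra! h
        exact hxo R hR.1 ⟨h, hx.2⟩⟩
    refine ⟨m, hm.1, le_antisymm ?_ hm.2⟩
    by_contra! h
    obtain ⟨t, ht, htm⟩ := exists_mem_supp_Ioo (f := f.toHomeo) h fun z hz =>
      hsub ⟨lt_trans hx.1 hz.1, hz.2.trans_le (hm.1.1.le.trans (hR.2 m hm.1))⟩
    obtain ⟨p, hp, htp⟩ := exists_orbital ht
    have hpx : x ≤ p.1 := by
      by_contra! h'
      exact hxo p hp ⟨h', htm.1.trans htp.2⟩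
    exact absurd (htp.1.trans htm.2) (not_lt.2 (hm' p ⟨hp, hpx⟩))

/-- A point of the hull outside the orbitals of `g` is both a right end and a left end of orbitals
of `g`; fastness prevents another generator from sharing an end on the same side. -/
lemma IsStandard.exists_orbital_of_transition (hg : g.IsStandard) {S : Set MarkedFunction}
    (hS : IsFast S) (hfS : f ∈ S) (hgS : g ∈ S) (hfg : f ≠ g) {L R : I × I}
    (hL : IsLeftmost g.toHomeo L) (hR : IsRightmost g.toHomeo R) {x : I} (hx : x ∈ Ioo L.1 R.2)
    (hxf : x ∈ transitionPoints f.toHomeo) : ∃ p ∈ orbitals g.toHomeo, x ∈ Ioo p.1 p.2 := by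
  refine (hg.mem_orbital_or hL hR hx).resolve_right ?_
  rintro ⟨⟨p, hp, h1⟩, q, hq, h2⟩
  obtain ⟨r, hr, h | h⟩ := hxf
  · exact hS.fst_ne hfS hgS hfg hr hq (h ▸ h2.symm)
  · exact hS.snd_ne hfS hgS hfg hr hp (h ▸ h1.symm)

lemma LL.snd_le_fst (h : LL f g) {p q : I × I} (hp : p ∈ orbitals f.toHomeo)
    (hq : q ∈ orbitals g.toHomeo) : p.2 ≤ q.1 := by
  by_contra! hlt
  obtain ⟨x, hx, hx'⟩ := exists_between (max_lt hp.1 hlt)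
  rw [max_lt_iff] at hx
  obtain ⟨y, hy, hy'⟩ := exists_between (lt_min hq.1 hx.2)
  rw [lt_min_iff] at hy'
  exact absurd (h x (Ioo_subset_extSupp hp ⟨hx.1, hx'⟩) y (Ioo_subset_extSupp hq ⟨hy, hy'.1⟩))
    (not_lt.2 hy'.2.le)

lemma SqSubset.lt (h : SqSubset f g) {L R L' R' : I × I}
    (hL : IsLeftmost g.toHomeo L) (hR : IsRightmost g.toHomeo R) (hL' : IsLeftmost f.toHomeo L')
    (hR' : IsRightmost f.toHomeo R') : L.1 < L'.1 ∧ R'.2 < R.2 := by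
  have h1 : (L'.1 : ℝ) ≤ L'.2 := hL'.1.1.le
  have h2 : (R'.1 : ℝ) ≤ R'.2 := hR'.1.1.le
  exact ⟨(extSupp_subset hL hR (h (Icc_subset_closure_extSupp hL'.1 (left_mem_Icc.2 h1)))).1,
    (extSupp_subset hL hR (h (Icc_subset_closure_extSupp hR'.1 (right_mem_Icc.2 h2)))).2⟩

lemma not_LL_of_SqSubset (hf : f.IsStandard) (h : SqSubset f g) : ¬ LL f g := by
  intro h'
  obtain ⟨x, hx⟩ := hf.extSupp_nonempty
  exact lt_irrefl x (h' x hx x (h (subset_closure hx)))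

lemma not_LL_of_SqSubset' (hf : f.IsStandard) (h : SqSubset f g) : ¬ LL g f := by
  intro h'
  obtain ⟨x, hx⟩ := hf.extSupp_nonempty
  exact lt_irrefl x (h' x (h (subset_closure hx)) x hx)

lemma ne_of_SqSubset (hf : f.IsStandard) (h : SqSubset f g) : f ≠ g := by
  rintro rfl
  obtain ⟨L, R, hL, hR⟩ := hf.exists_leftmost_rightmost
  exact lt_irrefl _ (h.lt hL hR hL hR).1

lemma StandardPair.isStandard (h : StandardPair f g) :
    f.IsStandard ∧ g.IsStandard ∧ IsFast {f, g} := by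
  cases h with
  | of_ll hf hg hfast _ => exact ⟨hf, hg, hfast⟩
  | of_sqSubset _ hf hg hfast _ _ _ => exact ⟨hf, hg, hfast⟩

lemma StandardPair.LL_or (h : StandardPair f g) : LL f g ∨ SqSubset f g := by
  cases h with
  | of_ll _ _ _ h => exact Or.inl h
  | of_sqSubset _ _ _ _ h _ _ => exact Or.inr h

lemma IsTrimmed.mem_orbitals_iff {g' : MarkedFunction} (h : IsTrimmed g g') {p : I × I} :
    p ∈ orbitals g'.toHomeo ↔
      p ∈ orbitals g.toHomeo ∧ ¬ IsLeftmost g.toHomeo p ∧ ¬ IsRightmost g.toHomeo p := by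
  have key : ∀ p ∈ orbitals g.toHomeo, ¬ IsLeftmost g.toHomeo p → ¬ IsRightmost g.toHomeo p →
      p ∈ orbitals g'.toHomeo := by
    intro p hp h1 h2
    refine ⟨hp.1, h.2.1 _ (not_mem_supp_iff.2 hp.2.1), h.2.1 _ (not_mem_supp_iff.2 hp.2.2.1), ?_⟩
    intro t ht
    change g'.toHomeo t ≠ t
    rw [(h.1 p hp t ht).1 ⟨h1, h2⟩]
    exact hp.2.2.2 ht
  refine ⟨fun hp => ?_, fun hp => key p hp.1 hp.2.1 hp.2.2⟩
  obtain ⟨t, ht⟩ := exists_between hp.1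
  have ht' : g'.toHomeo t ≠ t := hp.2.2.2 ht
  obtain ⟨q, hq, htq⟩ := exists_orbital fun e => ht' (h.2.1 t (not_mem_supp_iff.2 e))
  have hq' : ¬ IsLeftmost g.toHomeo q ∧ ¬ IsRightmost g.toHomeo q := by
    by_contra hc
    exact ht' ((h.1 q hq t htq).2 (by tauto))
  obtain rfl := orbital_eq hp (key q hq hq'.1 hq'.2) ht htq
  exact ⟨hq, hq'⟩

/-- The outermost orbitals of a trimmed function. -/
lemma IsTrimmed.ends {g' : MarkedFunction} (h : IsTrimmed g g') (hg : g.IsStandard)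
    {L R L' R' : I × I} (hL : IsLeftmost g.toHomeo L)
    (hR : IsRightmost g.toHomeo R) (hL' : IsLeftmost g'.toHomeo L')
    (hR' : IsRightmost g'.toHomeo R') : L'.1 = L.2 ∧ R'.2 = R.1 ∧ L.2 ≤ R.1 := by
  have hLi := h.mem_orbitals_iff.1 hL'.1
  have hRi := h.mem_orbitals_iff.1 hR'.1
  have h1 : L.2 ≤ L'.1 := hL.snd_le hLi.1 fun e => hLi.2.1 (e ▸ hL)
  have h2 : R'.2 ≤ R.1 := hR.le_fst hRi.1 fun e => hRi.2.2 (e ▸ hR)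
  have hLR : L'.1 < R'.2 := hL'.1.1.trans_le (hR'.2 L' hL'.1)
  have hLnR : ∀ p, IsLeftmost g.toHomeo p → ¬ IsRightmost g.toHomeo p := by
    intro p hp hpR
    obtain rfl := hp.eq hL
    obtain rfl := hpR.eq hR
    exact absurd (hpR.1.1.trans_le (h1.trans (hLR.le.trans h2))) (lt_irrefl _)
  refine ⟨le_antisymm ?_ h1, le_antisymm h2 ?_, h1.trans (hLR.le.trans h2)⟩
  -- Orbitals are adjacent, so one starts at `L.2`, and it is neither of the two removed ones.
  · rcases hg.mem_orbital_or hL hR (x := L.2)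
      ⟨hL.1.1, lt_of_le_of_lt (h1.trans (hLR.le.trans h2)) hR.1.1⟩ with ⟨p, hp, hx⟩ | ⟨-, p, hp, hx⟩
    · exact absurd hx (snd_not_mem_Ioo hL.1 hp)
    · rw [← hx]
      refine hL'.2 p (h.mem_orbitals_iff.2 ⟨hp, fun hpL => ?_, fun hpR => ?_⟩)
      · obtain rfl := hpL.eq hL
        exact absurd hp.1 (by rw [hx]; exact lt_irrefl _)
      · obtain rfl := hpR.eq hR
        rw [hx] at h2
        exact absurd hLR (not_lt.2 (h2.trans h1))
  · rcases hg.mem_orbital_or hL hR (x := R.1)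
      ⟨lt_of_lt_of_le hL.1.1 (h1.trans (hLR.le.trans h2)), hR.1.1⟩ with ⟨p, hp, hx⟩ | ⟨⟨p, hp, hx⟩, -⟩
    · exact absurd hx (fst_not_mem_Ioo hR.1 hp)
    · rw [← hx]
      refine hR'.2 p (h.mem_orbitals_iff.2 ⟨hp, fun hpL => ?_, fun hpR => ?_⟩)
      · obtain rfl := hpL.eq hL
        rw [hx] at h1
        exact absurd hLR (not_lt.2 (h2.trans h1))
      · obtain rfl := hpR.eq hR
        exact absurd hp.1 (by rw [hx]; exact lt_irrefl _)

/-- The reduction of a function with at most two bumps is supported at the left end of its rightmost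
orbital. -/
lemma IsFootBump.ends {g' : MarkedFunction} (h : IsFootBump g g') (hg : g.IsStandard)
    (hcard : (orbitals g.toHomeo).ncard ≤ 2) {L R : I × I} (hL : IsLeftmost g.toHomeo L)
    (hR : IsRightmost g.toHomeo R) :
    (∃ s, R.1 < s ∧ IsLeftmost g'.toHomeo (R.1, s) ∧ IsRightmost g'.toHomeo (R.1, s)) ∧
      (L = R ∨ L.2 = R.1) ∧ ∀ p ∈ orbitals g.toHomeo, p = L ∨ p = R := by
  obtain ⟨⟨p, hp⟩, hpos, horb, -⟩ := h
  have hfin := hg.finite_orbitals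
  have hall : ∀ q ∈ orbitals g.toHomeo, q = L ∨ q = R := by
    intro q hq
    by_contra! hc
    by_cases hLR : L = R
    · subst hLR
      rcases snd_le_fst_or hq hL.1 hc.1 with h | h
      · exact absurd (h.trans (hL.2 q hq)) (not_le.2 hq.1)
      · exact absurd ((hR.2 q hq).trans h) (not_le.2 hq.1)
    · have hsub : ({q, L, R} : Set (I × I)) ⊆ orbitals g.toHomeo := by
        rintro r (rfl | rfl | rfl)
        exacts [hq, hL.1, hR.1]
      have h3 := Set.ncard_le_ncard hsub hfin
      rw [Set.ncard_eq_three.2 ⟨q, L, R, hc.1, hc.2, hLR, rfl⟩] at h3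
      omega
  -- If the chosen positive orbital were not the rightmost, both orbitals would be positive; two
  -- positive orbitals require a negative one, a third.
  have hpR : p = R := by
    rcases hall p hp with rfl | rfl
    · by_contra hne
      have hRpos : R ∉ negOrbitals g.toHomeo := by
        intro hneg
        have := hg.neg_left_of_pos R hneg p hpos
        exact absurd (this.trans (hL.2 R hR.1)) (not_le.2 hR.1.1)
      have hRpos' : R ∈ posOrbitals g.toHomeo :=
        ⟨hR.1, (lt_apply_or_apply_lt hR.1).resolve_right fun h => hRpos ⟨hR.1, h⟩⟩
      have hnpos : 2 ≤ (posOrbitals g.toHomeo).ncard := by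
        rw [← Set.ncard_pair hne]
        refine Set.ncard_le_ncard ?_ (hfin.subset fun r hr => hr.1)
        rintro r (rfl | rfl)
        exacts [hpos, hRpos']
      have hneg : 0 < (negOrbitals g.toHomeo).ncard := by
        have := hg.pos_le_neg
        omega
      obtain ⟨r, hr⟩ := (Set.ncard_pos (hfin.subset fun r hr => hr.1)).1 hneg
      obtain ⟨t, ht⟩ := exists_between hr.1.1
      have hr2 := hr.2 t ht
      rcases hall r hr.1 with rfl | rfl
      · exact absurd (hpos.2 t ht) hr2.not_gt
      · exact absurd (hRpos'.2 t ht) hr2.not_gt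
    · rfl
  subst hpR
  have hm := g.marker_mem ⟨p, hp⟩
  refine ⟨⟨g.marker ⟨p, hp⟩, hm.1, ⟨by rw [horb]; rfl, ?_⟩, by rw [horb]; rfl, ?_⟩, ?_, hall⟩
  · intro q hq
    rw [horb] at hq
    rw [show q = _ from hq]
  · intro q hq
    rw [horb] at hq
    rw [show q = _ from hq]
  · rw [or_iff_not_imp_left]
    intro hLR
    have hle := hL.snd_le hp (Ne.symm hLR)
    rcases hg.mem_orbital_or hL hR (x := L.2) ⟨hL.1.1, hle.trans_lt hp.1⟩ with
      ⟨q, hq, hx⟩ | ⟨-, q, hq, hx⟩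
    · exact absurd hx (snd_not_mem_Ioo hL.1 hq)
    · rcases hall q hq with rfl | rfl
      · exact absurd hq.1 (by rw [hx]; exact lt_irrefl _)
      · exact hx.symm

/-- The relative position of the outermost orbitals of the functions of a standard pair. -/
lemma StandardPair.position (h : StandardPair f g) (hsq : SqSubset f g) {L R L' R' : I × I}
    (hL : IsLeftmost g.toHomeo L) (hR : IsRightmost g.toHomeo R) (hL' : IsLeftmost f.toHomeo L')
    (hR' : IsRightmost f.toHomeo R') :
    R.1 < R'.2 ∧ (R.1 < L'.1 ∨ (L'.1 < L.2 ∧ L.2 ≤ R.1)) := by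
  cases h with
  | of_ll hf hg hfast h => exact absurd h (not_LL_of_SqSubset hf hsq)
  | of_sqSubset g' hf hg hfast _ hg' hpair =>
    have hlt := hsq.lt hL hR hL' hR'
    have hLR' : L'.1 < R'.2 := hL'.1.1.trans_le (hR'.2 L' hL'.1)
    have hne := ne_of_SqSubset hf hsq
    obtain ⟨L'', R'', hL'', hR''⟩ := hpair.isStandard.1.exists_leftmost_rightmost
    -- The hull of `g°` runs from `L.2` to `R.1`, or starts at `R.1` for a foot bump. So `g° ≪ f`
    -- puts `f` inside the rightmost orbital of `g`, and `g° ⊏ f` makes `f` reach back into the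
    -- leftmost one.
    rcases hg' with ⟨-, htrim⟩ | ⟨hcard, hfoot⟩
    · obtain ⟨h1, h2, h3⟩ := htrim.ends hg hL hR hL'' hR''
      rcases hpair.LL_or with hll | hsq'
      · have h4 := hll.snd_le_fst hR''.1 hL'.1
        rw [h2] at h4
        have h5 : R.1 ≠ L'.1 :=
          (hfast.fst_ne (f := f) (g := g) (by simp) (by simp) hne hL'.1 hR.1).symm
        have h6 := lt_of_le_of_ne h4 h5
        exact ⟨h6.trans hLR', Or.inl h6⟩
      · have h4 := hsq'.lt hL' hR' hL'' hR''
        rw [h1, h2] at h4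
        exact ⟨h4.2, Or.inr ⟨h4.1, h3⟩⟩
    · obtain ⟨⟨s, hs, hsL, hsR⟩, hor, -⟩ := hfoot.ends hg hcard hL hR
      rcases hpair.LL_or with hll | hsq'
      · have h4 := hs.trans_le (hll.snd_le_fst hsR.1 hL'.1)
        exact ⟨h4.trans hLR', Or.inl h4⟩
      · have h4 := hsq'.lt hL' hR' hsL hsR
        refine ⟨hs.trans h4.2, Or.inr ?_⟩
        rcases hor with rfl | h5
        · exact absurd hlt.1 h4.1.not_gt
        · exact ⟨h5 ▸ h4.1, h5.le⟩

lemma transition_mem_Icc {f : I ≃o I} {L R : I × I} (hL : IsLeftmost f L) (hR : IsRightmost f R)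
    {t : I} (ht : t ∈ transitionPoints f) : t ∈ Icc L.1 R.2 := by
  obtain ⟨p, hp, rfl | rfl⟩ := ht
  · exact ⟨hL.2 p hp, hp.1.le.trans (hR.2 p hp)⟩
  · exact ⟨(hL.2 p hp).trans hp.1.le, hR.2 p hp⟩

lemma orbital_subset {f : I ≃o I} {L R : I × I} (hL : IsLeftmost f L) (hR : IsRightmost f R)
    {p : I × I} (hp : p ∈ orbitals f) {t : I} (ht : t ∈ Ioo p.1 p.2) : t ∈ Ioo L.1 R.2 :=
  ⟨(hL.2 p hp).trans_lt ht.1, ht.2.trans_le (hR.2 p hp)⟩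

/-- In a standard pair the orbitals that contain transition points of the other function are all
connected to the rightmost orbital of the larger function. -/
theorem StandardPair.linked (h : StandardPair f g) (𝓡 : Set (I × I))
    (hcl : ∀ p ∈ 𝓡, ∀ q ∈ orbitals f.toHomeo ∪ orbitals g.toHomeo,
      p.1 ∈ Ioo q.1 q.2 ∨ p.2 ∈ Ioo q.1 q.2 → q ∈ 𝓡)
    (hR𝓡 : ∀ R, IsRightmost g.toHomeo R → R ∈ 𝓡) :
    (∀ q ∈ orbitals f.toHomeo, ∀ t ∈ transitionPoints g.toHomeo, t ∈ Ioo q.1 q.2 → q ∈ 𝓡) ∧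
    ∀ q ∈ orbitals g.toHomeo, ∀ t ∈ transitionPoints f.toHomeo, t ∈ Ioo q.1 q.2 → q ∈ 𝓡 := by
  induction h with
  | @of_ll f g hf hg hfast h =>
    constructor
    · rintro q hq t ⟨p, hp, ht⟩ htq
      have h1 := h.snd_le_fst hq hp
      rcases ht with rfl | rfl
      · exact absurd htq.2 (not_lt.2 h1)
      · exact absurd (htq.2.trans_le (h1.trans hp.1.le)) (lt_irrefl _)
    · rintro q hq t ⟨p, hp, ht⟩ htq
      have h1 := h.snd_le_fst hp hq
      rcases ht with rfl | rfl
      · exact absurd (htq.1.trans (hp.1.trans_le h1)) (lt_irrefl _)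
      · exact absurd htq.1 (not_lt.2 h1)
  | @of_sqSubset f g g' hf hg hfast hsq hg' hpair ih =>
    have hpair' := StandardPair.of_sqSubset g' hf hg hfast hsq hg' hpair
    obtain ⟨L, R, hL, hR⟩ := hg.exists_leftmost_rightmost
    obtain ⟨L', R', hL', hR'⟩ := hf.exists_leftmost_rightmost
    obtain ⟨L'', R'', hL'', hR''⟩ := hpair.isStandard.1.exists_leftmost_rightmost
    have hlt := hsq.lt hL hR hL' hR'
    have hne := ne_of_SqSubset hf hsq
    have hRmem := hR𝓡 R hR
    obtain ⟨hpos1, hpos2⟩ := hpair'.position hsq hL hR hL' hR'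
    -- If `f` lies inside the rightmost orbital of `g`, that orbital is the only one involved.
    -- Otherwise `f` spans from the leftmost to the rightmost orbital of `g`.
    rcases hpos2 with hA | ⟨hB1, hB2⟩
    · constructor
      · rintro q hq t ⟨p, hp, ht⟩ htq
        exfalso
        have h1 := orbital_subset hL' hR' hq htq
        have h2 : t ∈ Ioo R.1 R.2 := ⟨hA.trans h1.1, h1.2.trans hlt.2⟩
        rcases ht with rfl | rfl
        · exact fst_not_mem_Ioo hp hR.1 h2
        · exact snd_not_mem_Ioo hp hR.1 h2
      · intro q hq t ht htq
        have h1 := transition_mem_Icc hL' hR' ht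
        have h2 : t ∈ Ioo R.1 R.2 := ⟨hA.trans_le h1.1, h1.2.trans_lt hlt.2⟩
        exact orbital_eq hq hR.1 htq h2 ▸ hRmem
    have hends : ∀ q ∈ orbitals f.toHomeo, ∀ t, t ∈ Ioo q.1 q.2 → t ≠ L.1 ∧ t ≠ R.2 := by
      intro q hq t htq
      have h1 := orbital_subset hL' hR' hq htq
      exact ⟨(hlt.1.trans h1.1).ne', (h1.2.trans hlt.2).ne⟩
    have hLmem : ∀ q ∈ 𝓡, q ∈ orbitals f.toHomeo → q.1 < L.2 → L ∈ 𝓡 := by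
      intro q hq hqf hqL
      exact hcl q hq L (Or.inr hL.1) (Or.inl ⟨hlt.1.trans_le (hL'.2 q hqf), hqL⟩)
    rcases hg' with ⟨-, htrim⟩ | ⟨hcard, hfoot⟩
    · obtain ⟨h1, h2, h3⟩ := htrim.ends hg hL hR hL'' hR''
      have hsq' : SqSubset g' f := by
        refine hpair.LL_or.resolve_left fun hll => ?_
        have := hll.snd_le_fst hR''.1 hL'.1
        rw [h2] at this
        exact absurd (hB1.trans_le (hB2.trans this)) (lt_irrefl _)
      obtain ⟨h4, h5⟩ := hpair.position hsq' hL' hR' hL'' hR''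
      -- The rightmost orbital of `f` contains `R.1`, so the induction hypothesis applies to `(g°,
      -- f)` with the roles exchanged. It covers all but the two trimmed orbitals of `g`.
      have hRmem' : R' ∈ 𝓡 := hcl R hRmem R' (Or.inl hR'.1) (Or.inl ⟨h2 ▸ h4, hpos1⟩)
      obtain ⟨ih1, ih2⟩ := ih
        (fun p hp q hq hpq => hcl p hp q (hq.elim
          (fun h => Or.inr (htrim.mem_orbitals_iff.1 h).1) Or.inl) hpq)
        (fun R₁ hR₁ => hR₁.eq hR' ▸ hRmem')
      have hf_orb : ∀ q ∈ orbitals f.toHomeo, ∀ t ∈ transitionPoints g.toHomeo,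
          t ∈ Ioo q.1 q.2 → q ∈ 𝓡 := by
        rintro q hq t ⟨p, hp, ht⟩ htq
        have hte := hends q hq t htq
        refine ih2 q hq t ?_ htq
        by_cases hpL : IsLeftmost g.toHomeo p
        · obtain rfl := hpL.eq hL
          exact ⟨L'', hL''.1, Or.inl ((ht.resolve_left hte.1).trans h1.symm)⟩
        by_cases hpR : IsRightmost g.toHomeo p
        · obtain rfl := hpR.eq hR
          exact ⟨R'', hR''.1, Or.inr ((ht.resolve_right hte.2).trans h2.symm)⟩
        exact ⟨p, htrim.mem_orbitals_iff.2 ⟨hp, hpL, hpR⟩, ht⟩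
      refine ⟨hf_orb, fun q hq t ht htq => ?_⟩
      by_cases hqL : IsLeftmost g.toHomeo q
      · obtain rfl := hqL.eq hL
        -- The leftmost orbital of `g` is reached through an orbital of `f` whose left end it
        -- contains: the rightmost one of `f` if that starts before `L.2`, otherwise the leftmost
        -- one, which contains `L.2`.
        rcases h5 with h5 | ⟨h5, -⟩
        · exact hLmem R' hRmem' hR'.1 (h1 ▸ h5)
        · have h6 := (hsq'.lt hL' hR' hL'' hR'').1
          exact hLmem L' (ih2 L' hL'.1 L''.1 ⟨L'', hL''.1, Or.inl rfl⟩ ⟨h6, h5⟩) hL'.1 hB1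
      by_cases hqR : IsRightmost g.toHomeo q
      · exact hqR.eq hR ▸ hRmem
      exact ih1 q (htrim.mem_orbitals_iff.2 ⟨hq, hqL, hqR⟩) t ht htq
    · obtain ⟨-, hor, hall⟩ := hfoot.ends hg hcard hL hR
      have hLR : L.2 = R.1 := hor.resolve_left fun e => by
        rw [e] at hB2
        exact absurd hR.1.1 (not_lt.2 hB2)
      constructor
      · rintro q hq t ⟨p, hp, ht⟩ htq
        have hte := hends q hq t htq
        have hR1 : t = R.1 := by
          rcases hall p hp with rfl | rfl
          · exact (ht.resolve_left hte.1).trans hLR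
          · exact ht.resolve_right hte.2
        exact hcl R hRmem q (Or.inl hq) (Or.inl (hR1 ▸ htq))
      · intro q hq t ht htq
        rcases hall q hq with rfl | rfl
        · obtain ⟨Q, hQ, hxQ⟩ := hf.exists_orbital_of_transition hfast (f := g) (by simp) (by simp)
            hne.symm hL' hR' (x := R.1) ⟨hLR ▸ hB1, hpos1⟩ ⟨R, hR.1, Or.inl rfl⟩
          exact hLmem Q (hcl R hRmem Q (Or.inl hQ) (Or.inl hxQ)) hQ (hLR ▸ hxQ.1)
        · exact hRmem

end Standard
end MarkedFunction
end OscGroups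

/-! ### Faithfulness of standard generating sets -/

namespace OscGroups
namespace MarkedFunction

variable {S : Set MarkedFunction}

lemma IsStandardGeneratingSet.subset {T : Set MarkedFunction} (hS : IsStandardGeneratingSet S)
    (hT : T ⊆ S) : IsStandardGeneratingSet T where
  finite := hS.finite.subset hT
  isStandard f hf := hS.isStandard f (hT hf)
  standardPair f hf g hg := hS.standardPair f (hT hf) g (hT hg)

lemma bumpFeet_subset {f : MarkedFunction} (p : orbitals f.toHomeo) :
    f.bumpFeet p ⊆ Ioo p.1.1 p.1.2 := by
  have h1 := f.marker_mem p
  have h2 := f.marker_lt_endMarker p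
  rintro x (hx | hx)
  · exact ⟨hx.1, hx.2.trans h1.2⟩
  · exact ⟨h1.1.trans (h2.trans_le hx.1), hx.2⟩

lemma IsStandardGeneratingSet.isFast (hS : IsStandardGeneratingSet S) : IsFast S := by
  intro f hf g hg p q hpq
  by_cases hfg : f = g
  · subst hfg
    refine Set.disjoint_left.2 fun x hx hx' => hpq ⟨rfl, ?_⟩
    exact orbital_eq p.2 q.2 (bumpFeet_subset p hx) (bumpFeet_subset q hx')
  · rcases hS.standardPair f hf g hg hfg with h | h
    · exact h.isStandard.2.2 f (by simp) g (by simp) p q hpq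
    · exact h.isStandard.2.2 f (by simp) g (by simp) p q hpq

section Rigid

variable {X : Set I}

lemma zpow_apply_mem (hX : ∀ g ∈ gen S, ∀ t ∈ X, g t ∈ X) {f : MarkedFunction} (hf : f ∈ S)
    {t : I} (ht : t ∈ X) (n : ℤ) : (f.toHomeo ^ n) t ∈ X := by
  have hfS : f.toHomeo ∈ gen S := Subgroup.subset_closure ⟨f, hf, rfl⟩
  exact hX _ (zpow_mem hfS n) t ht

/-- An orbital that contains a transition point of another generator meets the orbits that meet the
rightmost orbitals. -/
lemma IsStandardGeneratingSet.exists_mem_orbital (hS : IsStandardGeneratingSet S)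
    (hX : ∀ g ∈ gen S, ∀ t ∈ X, g t ∈ X)
    (hXr : ∀ f ∈ S, ∀ R, IsRightmost f.toHomeo R → ∃ t ∈ X, t ∈ Ioo R.1 R.2)
    {f e : MarkedFunction} (hf : f ∈ S) (he : e ∈ S) (hfe : f ≠ e) {q : I × I}
    (hq : q ∈ orbitals f.toHomeo) {x : I} (hx : x ∈ transitionPoints e.toHomeo)
    (hxq : x ∈ Ioo q.1 q.2) : ∃ t ∈ X, t ∈ Ioo q.1 q.2 := by
  -- Powers of a generator carry a point of `X` towards either end of its orbital, hence into any
  -- orbital containing that end. So the orbitals that meet `X` form a family as in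
  -- `StandardPair.linked`.
  have hcl : ∀ g ∈ S, ∀ p ∈ orbitals g.toHomeo, (∃ t ∈ X, t ∈ Ioo p.1 p.2) → ∀ r : I × I,
      p.1 ∈ Ioo r.1 r.2 ∨ p.2 ∈ Ioo r.1 r.2 → ∃ t ∈ X, t ∈ Ioo r.1 r.2 := by
    rintro g hg p hp ⟨t, ht, htp⟩ r (h | h)
    · obtain ⟨n, hn, hn'⟩ := exists_zpow_apply_lt hp htp h.2
      exact ⟨_, zpow_apply_mem hX hg ht n, h.1.trans hn.1, hn'⟩
    · obtain ⟨n, hn, hn'⟩ := exists_lt_zpow_apply hp htp h.1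
      exact ⟨_, zpow_apply_mem hX hg ht n, hn', hn.2.trans h.2⟩
  rcases hS.standardPair f hf e he hfe with h | h
  · exact ((h.linked {p | p ∈ orbitals f.toHomeo ∪ orbitals e.toHomeo ∧ ∃ t ∈ X, t ∈ Ioo p.1 p.2}
      (fun p hp r hr hpr => ⟨hr, hp.1.elim (fun h => hcl f hf p h hp.2 r hpr)
        fun h => hcl e he p h hp.2 r hpr⟩)
      (fun R hR => ⟨Or.inr hR.1, hXr e he R hR⟩)).1 q hq x hx hxq).2
  · exact ((h.linked {p | p ∈ orbitals e.toHomeo ∪ orbitals f.toHomeo ∧ ∃ t ∈ X, t ∈ Ioo p.1 p.2}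
      (fun p hp r hr hpr => ⟨hr, hp.1.elim (fun h => hcl e he p h hp.2 r hpr)
        fun h => hcl f hf p h hp.2 r hpr⟩)
      (fun R hR => ⟨Or.inr hR.1, hXr f hf R hR⟩)).2 q hq x hx hxq).2

/-- Since `q` misses `X`, it contains no end of `p`, so a foot of `p` that meets `q` belongs to an
orbital covering `q`. That foot then overlaps the foot of `q` on the same side, against fastness. -/
lemma IsStandardGeneratingSet.not_mem_feet (hS : IsStandardGeneratingSet S)
    (hX : ∀ g ∈ gen S, ∀ t ∈ X, g t ∈ X)
    (hXr : ∀ f ∈ S, ∀ R, IsRightmost f.toHomeo R → ∃ t ∈ X, t ∈ Ioo R.1 R.2)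
    {f e : MarkedFunction} (hf : f ∈ S) (he : e ∈ S) (hfe : f ≠ e) {q : I × I}
    (hq : q ∈ orbitals f.toHomeo) (hqX : ∀ t ∈ X, t ∉ Ioo q.1 q.2) (p : orbitals e.toHomeo)
    {z : I} (hz : z ∈ Ico q.1 q.2) : z ∉ e.leftFoot p ∪ e.rightFoot p := by
  intro hzp
  have hno : ∀ x ∈ transitionPoints e.toHomeo, x ∉ Ioo q.1 q.2 := by
    intro x hx hxq
    obtain ⟨t, ht, htq⟩ := hS.exists_mem_orbital hX hXr hf he hfe hq hx hxq
    exact hqX t ht htq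
  have hzI : z ∈ Ico p.1.1 p.1.2 :=
    hzp.elim (fun h => leftFoot_subset h) fun h => rightFoot_subset h
  have h1 : p.1.1 ≤ q.1 := by
    by_contra! h
    exact hno _ ⟨p.1, p.2, Or.inl rfl⟩ ⟨h, hzI.1.trans_lt hz.2⟩
  have h2 : q.2 ≤ p.1.2 := by
    by_contra! h
    exact hno _ ⟨p.1, p.2, Or.inr rfl⟩ ⟨hz.1.trans_lt hzI.2, h⟩
  have hm := f.marker_mem ⟨q, hq⟩
  have he' := f.endMarker_lt ⟨q, hq⟩
  rcases hzp with h | h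
  · exact hfe (hS.isFast.eq_of_mem hf he (p := ⟨q, hq⟩) (q := p) (x := q.1)
      (Or.inl ⟨le_rfl, hm.1⟩) (Or.inl ⟨h1, hz.1.trans_lt h.2⟩)).1
  · have h3 : max z (f.endMarker ⟨q, hq⟩) < q.2 := max_lt hz.2 he'
    exact hfe (hS.isFast.eq_of_mem hf he (p := ⟨q, hq⟩) (q := p)
      (x := max z (f.endMarker ⟨q, hq⟩)) (Or.inr ⟨le_max_right _ _, h3⟩)
      (Or.inr ⟨h.1.trans (le_max_left _ _), h3.trans_le h2⟩)).1

/-- The foot itself is the anchor: the letter pushes it into itself, and powers of `f` bring a point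
of `X` into it. -/
lemma isAnchor_target (hS : IsFast S) (hX : ∀ g ∈ gen S, ∀ t ∈ X, g t ∈ X) {f : S} {b : Bool}
    {p : orbitals f.1.toHomeo} {x : I} (hx : x ∈ f.1.target p b) {t : I} (ht : t ∈ X)
    (htp : t ∈ Ioo p.1.1 p.1.2) : (pingPong S hS).IsAnchor X (f.1.target p b) (f, b) x := by
  have hIco : ∀ y ∈ f.1.target p b, y ∈ Ico p.1.1 p.1.2 := fun y hy =>
    (mem_feet_of_mem_target hy).elim (fun h => leftFoot_subset h) fun h => rightFoot_subset h
  have hm := f.1.marker_mem p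
  have he := f.1.endMarker_lt p
  obtain ⟨u, v, huv, hE, hu, hv⟩ : ∃ u v, f.1.target p b = Ico u v ∧ u < v ∧
      (p.1.1 = u ∨ v = p.1.2) ∧ u ∈ Ico p.1.1 p.1.2 ∧ v ∈ Ioc p.1.1 p.1.2 := by
    rcases target_eq (f := f.1) (p := p) b with ⟨h, -⟩ | ⟨h, -⟩
    · exact ⟨_, _, h, hm.1, Or.inl rfl, ⟨le_rfl, p.2.1⟩, hm.1, hm.2.le⟩
    · exact ⟨_, _, h, he, Or.inr rfl,
        ⟨(hm.1.trans (f.1.marker_lt_endMarker p)).le, he⟩, p.2.1, le_rfl⟩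
  refine ⟨?_, ?_, ?_, hx, ?_, ?_⟩
  · rw [huv]
    exact ordConnected_Ico
  · exact fun y hy => mem_foot_pingPong.2 ⟨p, hy⟩
  · exact fun y hy => signed_mem_target (hIco y hy) (Set.disjoint_left.1 (disjoint_target b) hy)
  · rw [huv] at hx ⊢
    exact ⟨v, hx.2, Ico_subset_Ico_left hx.1⟩
  · obtain ⟨n, hn, hnE⟩ : ∃ n : ℤ, (f.1.toHomeo ^ n) t ∈ Ioo p.1.1 p.1.2 ∧
        (f.1.toHomeo ^ n) t ∈ Ico u v := by
      rcases hu with rfl | rfl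
      · obtain ⟨n, hn, hn'⟩ := exists_zpow_apply_lt p.2 htp hE
        exact ⟨n, hn, hn.1.le, hn'⟩
      · obtain ⟨n, hn, hn'⟩ := exists_lt_zpow_apply p.2 htp hE
        exact ⟨n, hn, hn'.le, hn.2⟩
    refine ⟨_, zpow_apply_mem hX f.2 ht n, by rwa [huv], ?_⟩
    have hsupp : f.1.toHomeo ((f.1.toHomeo ^ n) t) ≠ (f.1.toHomeo ^ n) t := p.2.2.2.2 hn
    cases b
    · change f.1.toHomeo⁻¹ _ ≠ _
      intro e
      apply hsupp
      conv_lhs => rw [← e]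
      exact orderIso_apply_inv_self _ _
    · exact hsupp

/-- Points in orbitals that an orbit does not meet are rigid. -/
lemma IsStandardGeneratingSet.rigid_of_isolated (hS : IsStandardGeneratingSet S)
    (hX : ∀ g ∈ gen S, ∀ t ∈ X, g t ∈ X)
    (hXr : ∀ f ∈ S, ∀ R, IsRightmost f.toHomeo R → ∃ t ∈ X, t ∈ Ioo R.1 R.2)
    {f : MarkedFunction} (hf : f ∈ S) {q : I × I}
    (hq : q ∈ orbitals f.toHomeo) (hqX : ∀ t ∈ X, t ∉ Ioo q.1 q.2) {x : I}
    (hx : x ∈ Ico q.1 q.2) : (pingPong S hS.isFast).Rigid X x := by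
  obtain ⟨L, R, hL, hR⟩ := (hS.isStandard f hf).exists_leftmost_rightmost
  have hqR : q ≠ R := by
    rintro rfl
    obtain ⟨t, ht, htq⟩ := hXr f hf _ hR
    exact hqX t ht htq
  -- `r` is the first orbital of `f` to the right of `q` that meets `X`; it exists because the
  -- rightmost one does.
  obtain ⟨r, ⟨hr, hqr, t, ht, htr⟩, hr'⟩ := Set.exists_min_image
    {r ∈ orbitals f.toHomeo | q.2 ≤ r.1 ∧ ∃ t ∈ X, t ∈ Ioo r.1 r.2} Prod.fst
    ((hS.isStandard f hf).finite_orbitals.subset (sep_subset _ _))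
    ⟨R, hR.1, hR.le_fst hq hqR, hXr f hf R hR⟩
  have hmq := f.marker_mem ⟨q, hq⟩
  have heq := f.endMarker_lt ⟨q, hq⟩
  have hmeq := f.marker_lt_endMarker ⟨q, hq⟩
  have hmr := f.marker_mem ⟨r, hr⟩
  dsimp only at hmq heq hmr
  -- From `q` up to the marker of `r` only feet of `f` occur: the orbitals before `r` miss `X`, so
  -- `not_mem_feet` applies to them, and the rest lies in left feet of `f`.
  have hfeet : ∀ e ∈ S, f ≠ e → ∀ (p : orbitals e.toHomeo), ∀ z ∈ Ico q.1 (f.marker ⟨r, hr⟩),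
      z ∉ e.leftFoot p ∪ e.rightFoot p := by
    intro e he hfe p z hz hzp
    have hleft : ∀ o (ho : o ∈ orbitals f.toHomeo), z ∉ f.leftFoot ⟨o, ho⟩ := fun o ho h =>
      hfe (hS.isFast.eq_of_mem hf he (Or.inl h) hzp).1
    have hzr : z < r.1 := by
      by_contra! h
      exact hleft r hr ⟨h, hz.2⟩
    have hqz : q.1 < z := by
      refine lt_of_le_of_ne hz.1 ?_
      rintro rfl
      exact hleft q hq ⟨le_rfl, hmq.1⟩
    rcases (hS.isStandard f hf).mem_orbital_or hL hR (x := z) ⟨(hL.2 q hq).trans_lt hqz,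
      hzr.trans (hr.1.trans_le (hR.2 r hr))⟩ with ⟨o, ho, hzo⟩ | ⟨-, o, ho, rfl⟩
    · refine hS.not_mem_feet hX hXr hf he hfe ho ?_ p ⟨hzo.1.le, hzo.2⟩ hzp
      by_cases hoq : q = o
      · exact hoq ▸ hqX
      · intro s hs hso
        rcases snd_le_fst_or hq ho hoq with h | h
        · exact absurd (hzo.1.trans hzr) (not_lt.2 (hr' o ⟨ho, h, s, hs, hso⟩))
        · exact absurd (hqz.trans (hzo.2.trans_le h)) (lt_irrefl _)
    · exact hleft o ho ⟨le_rfl, (f.marker_mem ⟨o, ho⟩).1⟩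
  have hmem : ∀ z, z ∈ f.leftFoot ⟨q, hq⟩ ∪ f.rightFoot ⟨q, hq⟩ →
      z ∈ Ico q.1 (f.marker ⟨r, hr⟩) := by
    intro z hz
    have hz' : z ∈ Ico q.1 q.2 := hz.elim (fun h => leftFoot_subset h) fun h => rightFoot_subset h
    exact ⟨hz'.1, hz'.2.trans (hqr.trans_lt hmr.1)⟩
  have hmeet : ∀ b, ¬ Disjoint (Ico q.1 (f.marker ⟨r, hr⟩))
      ((pingPong S hS.isFast).foot (⟨f, hf⟩, b)) := by
    intro b
    rw [Set.not_disjoint_iff]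
    rcases target_eq (f := f) (p := ⟨q, hq⟩) b with ⟨h, -⟩ | ⟨h, -⟩
    · have hz : q.1 ∈ f.leftFoot ⟨q, hq⟩ := ⟨le_rfl, hmq.1⟩
      exact ⟨_, hmem _ (Or.inl hz), mem_foot_pingPong.2 ⟨⟨q, hq⟩, by rwa [h]⟩⟩
    · have hz : f.endMarker ⟨q, hq⟩ ∈ f.rightFoot ⟨q, hq⟩ := ⟨le_rfl, heq⟩
      exact ⟨_, hmem _ (Or.inr hz), mem_foot_pingPong.2 ⟨⟨q, hq⟩, by rwa [h]⟩⟩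
  intro h hh hhX hhx z hz
  obtain ⟨k, y, hy, hyk⟩ := (pingPong S hS.isFast).eq_zpow_of_fixed (x₀ := q.1) (x := r.1)
    (s := f.marker ⟨r, hr⟩) (c := (⟨f, hf⟩, true)) hmr.1 hq.2.1 hr.2.1 (by
      rintro ⟨e, b⟩ h1 h2
      refine Set.disjoint_left.2 fun z hz hzb => ?_
      obtain ⟨p, hp⟩ := mem_foot_pingPong.1 hzb
      refine hfeet e.1 e.2 ?_ p z hz (mem_feet_of_mem_target hp)
      rintro rfl
      cases b
      · exact h2 rfl
      · exact h1 rfl) (hmeet true) (hmeet false) hh (z := x) ⟨hx.1, hx.2.trans_le hqr⟩ hhx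
  have hqr1 : q.1 < r.1 := hq.1.trans_le hqr
  -- Points of `X` in `r` accumulate at `r.1`. They are fixed by `h` but moved by every nonzero
  -- power of `f`.
  have hk : k = 0 := by
    by_contra hk
    obtain ⟨n, hn, hny⟩ := exists_zpow_apply_lt hr htr hy
    have h1 := hyk _ ⟨hqr1.le.trans hn.1.le, hny⟩
    rw [hhX _ (zpow_apply_mem hX hf ht n)] at h1
    exact zpow_apply_ne (f := f.toHomeo) (hr.2.2.2 hn) hk h1.symm
  refine ⟨y, (hx.2.trans_le hqr).trans hy, fun s hs => ?_⟩
  rw [hyk s ⟨hx.1.trans hs.1, hs.2⟩, hk]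
  simp

/-- The group acts faithfully on every invariant set that meets all rightmost orbitals. -/
theorem IsStandardGeneratingSet.eq_one_of_fixes (hS : IsStandardGeneratingSet S)
    (hX : ∀ g ∈ gen S, ∀ t ∈ X, g t ∈ X)
    (hXr : ∀ f ∈ S, ∀ R, IsRightmost f.toHomeo R → ∃ t ∈ X, t ∈ Ioo R.1 R.2)
    {h : I ≃o I} (hh : h ∈ gen S) (hhX : ∀ t ∈ X, h t = t) : h = 1 := by
  by_contra hne
  obtain ⟨t, ht⟩ : ∃ t, h t ≠ t := by
    by_contra! hc
    exact hne (OrderIso.ext (funext hc))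
  obtain ⟨p, hp, -⟩ := exists_orbital ht
  rw [← pingPong_group hS.isFast] at hX hh
  have hrigid := (pingPong S hS.isFast).rigid_of_anchors hX
    (exists_Ico_disjoint_foot hS.isFast hS.finite fun f hf => (hS.isStandard f hf).finite_orbitals)
    (by
      rintro ⟨f, b⟩ x hx
      rw [pingPong_group] at hX
      obtain ⟨q, hq⟩ := mem_foot_pingPong.1 hx
      by_cases hqX : ∃ t ∈ X, t ∈ Ioo q.1.1 q.1.2
      · obtain ⟨t, ht, htq⟩ := hqX
        exact Or.inr ⟨_, isAnchor_target hS.isFast hX hq ht htq⟩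
      · push Not at hqX
        exact Or.inl (hS.rigid_of_isolated hX hXr f.2 q.2 hqX
          ((mem_feet_of_mem_target hq).elim (fun h => leftFoot_subset h)
            fun h => rightFoot_subset h))) p.1
  obtain ⟨y, hy, hyt⟩ := hrigid h hh hhX hp.2.1 p.2 hp.1
  obtain ⟨s, hs, hs'⟩ := exists_between (lt_min hy hp.1)
  rw [lt_min_iff] at hs'
  exact hp.2.2.2 ⟨hs, hs'.2⟩ (hyt s ⟨hs.le, hs'.1⟩)

theorem IsStandardGeneratingSet.eq_of_smul_orbit (hS : IsStandardGeneratingSet S) {t₀ : I}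
    (ht₀ : InRightmostOrbitals S t₀) {g h : gen S}
    (hgh : ∀ k : gen S, g • k • t₀ = h • k • t₀) : g = h := by
  have h1 : (h⁻¹ * g : gen S).1 = 1 := by
    refine hS.eq_one_of_fixes (X := MulAction.orbit (gen S) t₀) ?_
      (fun f hf R hR => ⟨t₀, MulAction.mem_orbit_self t₀, ht₀ f hf R hR⟩) (h⁻¹ * g).2 ?_
    · rintro k hk _ ⟨l, rfl⟩
      exact ⟨⟨k, hk⟩ * l, mul_smul _ _ _⟩
    · rintro _ ⟨k, rfl⟩
      change (h⁻¹ * g) • k • t₀ = k • t₀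
      rw [mul_smul, hgh, inv_smul_smul]
  exact (inv_mul_eq_one.1 (Subtype.ext h1)).symm

end Rigid

/-! ### The point `t₀` and the separating interval -/

lemma osc_eq_zero_of_LL {f g : MarkedFunction} (h : LL f g) : osc f g = 0 := by
  rw [osc, show {p ∈ orbitals g.toHomeo | ∃ t ∈ transitionPoints f.toHomeo, t ∈ Ioo p.1 p.2} = ∅
    from ?_, Set.ncard_empty]
  rw [eq_empty_iff_forall_notMem]
  rintro p ⟨hp, t, ⟨q, hq, rfl | rfl⟩, ht⟩
  · exact absurd (ht.1.trans hq.1) (not_lt.2 (h.snd_le_fst hq hp))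
  · exact absurd ht.1 (not_lt.2 (h.snd_le_fst hq hp))

lemma IsStandardGeneratingSet.pair_of_lt (hS : IsStandardGeneratingSet S)
    (hpos : ∀ f ∈ S, ∀ g ∈ S, Lt f g → 0 < osc f g) {f g : MarkedFunction} (hf : f ∈ S)
    (hg : g ∈ S) (h : Lt f g) : StandardPair f g ∧ SqSubset f g := by
  have hsq : SqSubset f g := h.resolve_left fun hll => by
    have := hpos f hf g hg h
    rw [osc_eq_zero_of_LL hll] at this
    exact lt_irrefl _ this
  refine ⟨?_, hsq⟩
  have hfs := hS.isStandard f hf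
  rcases hS.standardPair f hf g hg (ne_of_SqSubset hfs hsq) with h' | h'
  · exact h'
  · exfalso
    rcases h'.LL_or with h1 | h1
    · exact not_LL_of_SqSubset' hfs hsq h1
    · obtain ⟨L, R, hL, hR⟩ := hfs.exists_leftmost_rightmost
      obtain ⟨L', R', hL', hR'⟩ := (hS.isStandard g hg).exists_leftmost_rightmost
      exact lt_asymm (hsq.lt hL' hR' hL hR).1 (h1.lt hL hR hL' hR').1

lemma IsStandardGeneratingSet.lt_or_gt (hS : IsStandardGeneratingSet S) {f g : MarkedFunction}
    (hf : f ∈ S) (hg : g ∈ S) (h : f ≠ g) : Lt f g ∨ Lt g f :=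
  (hS.standardPair f hf g hg h).imp StandardPair.LL_or StandardPair.LL_or

lemma IsStandardGeneratingSet.exists_inRightmostOrbitals (hS : IsStandardGeneratingSet S)
    (hpos : ∀ f ∈ S, ∀ g ∈ S, Lt f g → 0 < osc f g) (hne : S.Nonempty) :
    ∃ t₀, InRightmostOrbitals S t₀ := by
  have hex : ∀ f : S, ∃ R, IsRightmost f.1.toHomeo R := fun f => by
    obtain ⟨L, R, -, hR⟩ := (hS.isStandard f.1 f.2).exists_leftmost_rightmost
    exact ⟨R, hR⟩
  choose R hR using hex
  have : Finite S := hS.finite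
  have : Nonempty S := hne.to_subtype
  -- The rightmost orbitals meet pairwise, hence, being finitely many intervals, have a common point
  -- between the largest left end and the smallest right end.
  have hlt : ∀ f g : S, (R f).1 < (R g).2 := by
    intro f g
    by_cases hfg : f = g
    · exact hfg ▸ (hR f).1.1
    obtain ⟨L₁, R₁, hL₁, hR₁⟩ := (hS.isStandard f.1 f.2).exists_leftmost_rightmost
    obtain ⟨L₂, R₂, hL₂, hR₂⟩ := (hS.isStandard g.1 g.2).exists_leftmost_rightmost
    rcases hS.lt_or_gt f.2 g.2 (fun e => hfg (Subtype.ext e)) with h | h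
    · obtain ⟨-, h2⟩ := hS.pair_of_lt hpos f.2 g.2 h
      exact (hR f).1.1.trans (h2.lt hL₂ (hR g) hL₁ (hR f)).2
    · obtain ⟨h1, h2⟩ := hS.pair_of_lt hpos g.2 f.2 h
      exact (h1.position h2 hL₁ (hR f) hL₂ (hR g)).1
  obtain ⟨f, hf⟩ := Finite.exists_max fun f => (R f).1
  obtain ⟨g, hg⟩ := Finite.exists_min fun f => (R f).2
  obtain ⟨t, ht, ht'⟩ := exists_between (hlt f g)
  refine ⟨t, fun e he p hp => ?_⟩
  obtain rfl := hp.eq (hR ⟨e, he⟩)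
  exact ⟨(hf ⟨e, he⟩).trans_lt ht, ht'.trans_le (hg ⟨e, he⟩)⟩

/-- If the oscillation of a standard pair is `1`, then the smaller function lies between the feet of
the rightmost bump of the larger one. -/
lemma StandardPair.between_feet {b c : MarkedFunction} (h : StandardPair b c) (hsq : SqSubset b c)
    (hosc : osc b c = 1) {L R L' R' : I × I} (hL : IsLeftmost c.toHomeo L)
    (hR : IsRightmost c.toHomeo R) (hL' : IsLeftmost b.toHomeo L')
    (hR' : IsRightmost b.toHomeo R') :
    c.marker ⟨R, hR.1⟩ ≤ L'.1 ∧ R'.2 ≤ c.endMarker ⟨R, hR.1⟩ := by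
  obtain ⟨hbs, hcs, hfast⟩ := h.isStandard
  have hne := ne_of_SqSubset hbs hsq
  have hlt := hsq.lt hL hR hL' hR'
  obtain ⟨hpos1, hpos2⟩ := h.position hsq hL hR hL' hR'
  have hLR' : L'.1 < R'.2 := hL'.1.1.trans_le (hR'.2 L' hL'.1)
  -- If `b` reached back into the leftmost orbital of `c`, both outermost orbitals of `c` would
  -- contain transition points of `b`, and the oscillation would be at least `2`.
  have hRL : R.1 < L'.1 := by
    refine hpos2.resolve_right ?_
    rintro ⟨h1, h2⟩
    obtain ⟨o, ho⟩ := Set.ncard_eq_one.1 hosc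
    have hLo : L ∈ ({o} : Set (I × I)) := ho ▸
      ⟨hL.1, L'.1, ⟨L', hL'.1, Or.inl rfl⟩, hlt.1, h1⟩
    have hRo : R ∈ ({o} : Set (I × I)) := ho ▸
      ⟨hR.1, R'.2, ⟨R', hR'.1, Or.inr rfl⟩, hpos1, hlt.2⟩
    have e : L = R := hLo.trans hRo.symm
    rw [e] at h2
    exact absurd hR.1.1 (not_lt.2 h2)
  constructor
  · by_contra! hlt'
    exact hne (hfast.eq_of_mem (f := b) (g := c) (by simp) (by simp) (p := ⟨L', hL'.1⟩)
      (q := ⟨R, hR.1⟩) (x := L'.1) (Or.inl ⟨le_rfl, (b.marker_mem ⟨L', hL'.1⟩).1⟩)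
      (Or.inl ⟨hRL.le, hlt'⟩)).1
  · by_contra! hlt'
    have h1 : max (b.endMarker ⟨R', hR'.1⟩) (c.endMarker ⟨R, hR.1⟩) < R'.2 :=
      max_lt (b.endMarker_lt ⟨R', hR'.1⟩) hlt'
    exact hne (hfast.eq_of_mem (f := b) (g := c) (by simp) (by simp) (p := ⟨R', hR'.1⟩)
      (q := ⟨R, hR.1⟩) (x := max (b.endMarker ⟨R', hR'.1⟩) (c.endMarker ⟨R, hR.1⟩))
      (Or.inr ⟨le_max_left _ _, h1⟩) (Or.inr ⟨le_max_right _ _, h1.trans hlt.2⟩)).1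

lemma IsStandardGeneratingSet.exists_isSeparatingInterval {A B C : Set MarkedFunction}
    (hA : IsStandardGeneratingSet A) (hpos : ∀ f ∈ A, ∀ g ∈ A, Lt f g → 0 < osc f g)
    (hB : B.Nonempty) (hABC : IsStar A B C) : ∃ J, IsSeparatingInterval B C J := by
  have hBA : B ⊆ A := hABC.eq_union ▸ subset_union_left
  have hCA : C ⊆ A := hABC.eq_union ▸ subset_union_right
  have hex : ∀ f : A, ∃ L R, IsLeftmost f.1.toHomeo L ∧ IsRightmost f.1.toHomeo R := fun f =>
    (hA.isStandard f.1 f.2).exists_leftmost_rightmost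
  choose L R hL hR using hex
  have : Finite B := hA.finite.subset hBA
  have : Nonempty B := hB.to_subtype
  -- Positive oscillation turns `<` into `⊏`, so `B` has an element whose hull contains all others;
  -- this hull is `J`.
  obtain ⟨m, hm⟩ := Finite.exists_max fun b : B => (R ⟨b, hBA b.2⟩).2
  set M : A := ⟨m, hBA m.2⟩
  have hsub : ∀ b : B, (L M).1 ≤ (L ⟨b, hBA b.2⟩).1 ∧ (R ⟨b, hBA b.2⟩).2 ≤ (R M).2 := by
    intro b
    by_cases hbm : b = m
    · subst hbm
      exact ⟨le_rfl, le_rfl⟩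
    rcases hA.lt_or_gt (hBA b.2) (hBA m.2) (fun e => hbm (Subtype.ext e)) with h | h
    · have := (hA.pair_of_lt hpos (hBA b.2) (hBA m.2) h).2.lt (hL M) (hR M) (hL ⟨b, hBA b.2⟩)
        (hR ⟨b, hBA b.2⟩)
      exact ⟨this.1.le, this.2.le⟩
    · have := (hA.pair_of_lt hpos (hBA m.2) (hBA b.2) h).2.lt (hL ⟨b, hBA b.2⟩)
        (hR ⟨b, hBA b.2⟩) (hL M) (hR M)
      exact absurd this.2 (not_lt.2 (hm b))
  have hfeet : ∀ c (hc : c ∈ C), c.marker ⟨R ⟨c, hCA hc⟩, (hR ⟨c, hCA hc⟩).1⟩ ≤ (L M).1 ∧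
      (R M).2 ≤ c.endMarker ⟨R ⟨c, hCA hc⟩, (hR ⟨c, hCA hc⟩).1⟩ := by
    intro c hc
    obtain ⟨h1, h2⟩ := hA.pair_of_lt hpos (hBA m.2) (hCA hc) (hABC.lt m m.2 c hc)
    exact h1.between_feet h2 (hABC.osc_eq_one m m.2 c hc) (hL ⟨c, hCA hc⟩) (hR ⟨c, hCA hc⟩)
      (hL M) (hR M)
  have hin : ∀ c (hc : c ∈ C), Ioo (L M).1 (R M).2 ⊆
      Ioo (R ⟨c, hCA hc⟩).1 (R ⟨c, hCA hc⟩).2 := by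
    intro c hc
    have h1 := hfeet c hc
    have h2 := c.marker_mem ⟨R ⟨c, hCA hc⟩, (hR ⟨c, hCA hc⟩).1⟩
    have h3 := c.endMarker_lt ⟨R ⟨c, hCA hc⟩, (hR ⟨c, hCA hc⟩).1⟩
    exact Ioo_subset_Ioo (h2.1.le.trans h1.1) (h1.2.trans h3.le)
  refine ⟨Ioo (L M).1 (R M).2, ⟨_, _, rfl⟩, ?_, ?_, ?_⟩
  · intro b hb t ht
    obtain ⟨p, hp, htp⟩ := exists_orbital ht
    have h1 := orbital_subset (hL ⟨b, hBA hb⟩) (hR ⟨b, hBA hb⟩) hp htp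
    have h2 := hsub ⟨b, hb⟩
    exact ⟨h2.1.trans_lt h1.1, h1.2.trans_le h2.2⟩
  · intro c hc p hp
    obtain rfl := hp.eq (hR ⟨c, hCA hc⟩)
    exact hin c hc
  · intro c hc
    refine Set.disjoint_left.2 fun t ht htf => ?_
    obtain ⟨p, hp⟩ := mem_iUnion.1 htf
    have hpR := orbital_eq p.2 (hR ⟨c, hCA hc⟩).1 (bumpFeet_subset p hp) (hin c hc ht)
    obtain rfl : p = ⟨R ⟨c, hCA hc⟩, (hR ⟨c, hCA hc⟩).1⟩ := Subtype.ext hpR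
    have h1 := hfeet c hc
    rcases hp with hp | hp
    · exact absurd (ht.1.trans hp.2) (not_lt.2 h1.1)
    · exact absurd (ht.2.trans_le h1.2) (not_lt.2 hp.1)

/-- Ping-pong feet include left ends of orbitals; as `J` is open, containing such an end would make
it meet the open foot. -/
lemma IsSeparatingInterval.disjoint_foot {B C : Set MarkedFunction} {J : Set I}
    (hJ : IsSeparatingInterval B C J) (hC : IsFast C) (a : C × Bool) :
    Disjoint J ((pingPong C hC).foot a) := by
  obtain ⟨u, v, rfl⟩ := hJ.isInterval
  refine Set.disjoint_left.2 fun x hx hxa => ?_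
  obtain ⟨p, hp⟩ := mem_foot_pingPong.1 hxa
  obtain ⟨y, hy, hyp⟩ := exists_Ioo_subset_bumpFeet (mem_feet_of_mem_target hp)
  obtain ⟨t, ht, ht'⟩ := exists_between (lt_min hy hx.2)
  rw [lt_min_iff] at ht'
  exact Set.disjoint_left.1 (hJ.disjoint_feet a.1 a.1.2) ⟨hx.1.trans ht, ht'.2⟩
    (mem_iUnion.2 ⟨p, hyp ⟨ht, ht'.1⟩⟩)

lemma IsSeparatingInterval.isConsistent {B C : Set MarkedFunction} {J : Set I}
    (hJ : IsSeparatingInterval B C J) (hC : IsFast C) : IsConsistent (gen C) J := by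
  intro h hh hne
  rw [← pingPong_group hC] at hh
  refine (pingPong C hC).consistent ?_ (hJ.disjoint_foot hC) hh hne
  obtain ⟨u, v, rfl⟩ := hJ.isInterval
  exact ordConnected_Ioo

lemma IsStandardGeneratingSet.faithfulSMul_orbit (hS : IsStandardGeneratingSet S) {t₀ : I}
    (ht₀ : InRightmostOrbitals S t₀) : FaithfulSMul (gen S) (MulAction.orbit (gen S) t₀) :=
  ⟨fun h => hS.eq_of_smul_orbit ht₀ fun k =>
    congrArg Subtype.val (h ⟨k • t₀, MulAction.mem_orbit t₀ k⟩)⟩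

/-- If `g` and `h` agree on `kJ`, then `(hk)⁻¹gk` preserves `J`, so by consistency it fixes `t₀`.
This reduces the claim to the orbit of `t₀`. -/
lemma IsStandardGeneratingSet.faithfulSMul_orbit_set (hS : IsStandardGeneratingSet S) {t₀ : I}
    (ht₀ : InRightmostOrbitals S t₀) {J : Set I} (hJ : IsConsistent (gen S) J) (htJ : t₀ ∈ J) :
    FaithfulSMul (gen S) (MulAction.orbit (gen S) J) := by
  refine ⟨fun {g h} hgh => hS.eq_of_smul_orbit ht₀ fun k => ?_⟩
  have h1 : g • k • J = h • k • J :=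
    congrArg Subtype.val (hgh ⟨k • J, MulAction.mem_orbit J k⟩)
  have h2 : ((h * k)⁻¹ * (g * k)) • J = J := by
    rw [mul_smul, mul_smul g, h1, ← mul_smul h, inv_smul_smul]
  have h3 := hJ _ ((h * k)⁻¹ * (g * k)).2 ⟨t₀, h2.symm ▸ htJ, htJ⟩ t₀ htJ
  change ((h * k)⁻¹ * (g * k)) • t₀ = t₀ at h3
  rwa [mul_smul, inv_smul_eq_iff, mul_smul, mul_smul] at h3

lemma apply_eq_self_of_mem_gen {J : Set I} (h : ∀ f ∈ S, supp f.toHomeo ⊆ J) {g : I ≃o I}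
    (hg : g ∈ gen S) {t : I} (ht : t ∉ J) : g t = t := by
  have hle : gen S ≤ MulAction.stabilizer (I ≃o I) t := by
    rw [gen, Subgroup.closure_le]
    rintro _ ⟨f, hf, rfl⟩
    exact not_mem_supp_iff.1 fun hts => ht (h f hf hts)
  exact hle hg

end MarkedFunction
end OscGroups

/-! ### Assembly of the proposition -/

open OscGroups OscGroups.MarkedFunction in
theorem mainTheorem7 (A B C : Set MarkedFunction)
    (hA : IsStandardGeneratingSet A)
    (hpos : ∀ f ∈ A, ∀ g ∈ A, Lt f g → 0 < osc f g)
    (hB : B.Nonempty) (hC : C.Nonempty) (hABC : IsStar A B C) :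
    (∃ J : Set I, IsSeparatingInterval B C J) ∧ (∃ t₀ : I, InRightmostOrbitals B t₀) ∧
    ∀ (J : Set I) (t₀ : I), IsSeparatingInterval B C J → InRightmostOrbitals B t₀ →
      (FaithfulSMul (gen B) (MulAction.orbit (gen B) t₀) ∧ IsConsistent (gen B) {t₀}) ∧
      (FaithfulSMul (gen C) (MulAction.orbit (gen C) J) ∧ IsConsistent (gen C) J) ∧
      ∃ (Φ : PermWreath (gen B) (gen C) (MulAction.orbit (gen C) J) ≃* gen A)
        (Ψ : MulAction.orbit (gen B) t₀ × MulAction.orbit (gen C) J ≃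
          MulAction.orbit (gen A) t₀),
        (∀ (x : MulAction.orbit (gen B) t₀) (h : gen C),
          (Ψ (x, ⟨h • J, MulAction.mem_orbit J h⟩) : I) = h • (x : I)) ∧
        ∀ (w : PermWreath (gen B) (gen C) (MulAction.orbit (gen C) J))
          (z : MulAction.orbit (gen B) t₀ × MulAction.orbit (gen C) J),
          Ψ (w • z) = Φ w • Ψ z := by
  have hBA : B ⊆ A := hABC.eq_union ▸ subset_union_left
  have hCA : C ⊆ A := hABC.eq_union ▸ subset_union_right
  have hSB := hA.subset hBA
  have hSC := hA.subset hCA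
  refine ⟨hA.exists_isSeparatingInterval hpos hB hABC, hSB.exists_inRightmostOrbitals
    (fun f hf g hg => hpos f (hBA hf) g (hBA hg)) hB, fun J t₀ hJ ht₀ => ?_⟩
  obtain ⟨b, hb⟩ := hB
  obtain ⟨-, R, -, hR⟩ := (hSB.isStandard b hb).exists_leftmost_rightmost
  have htJ : t₀ ∈ J := hJ.supp_subset b hb (hR.1.2.2.2 (ht₀ b hb R hR))
  have hcons := hJ.isConsistent hSC.isFast
  -- As `J` lies in the rightmost orbitals of `C`, the same point `t₀` also serves for the
  -- faithfulness of `⟨C⟩`.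
  have ht₀C : InRightmostOrbitals C t₀ := fun c hc p hp => hJ.subset_rightmost c hc p hp htJ
  have hfaith := hSC.faithfulSMul_orbit_set ht₀C hcons htJ
  refine ⟨⟨hSB.faithfulSMul_orbit ht₀, ?_⟩, ⟨hfaith, hcons⟩, ?_⟩
  · rintro h - ⟨_, ⟨_, rfl, rfl⟩, h2⟩ _ rfl
    exact h2
  · have hw : WreathPair (gen B) (gen C) J := by
      refine ⟨?_, ⟨t₀, htJ⟩, fun g hg t ht => apply_eq_self_of_mem_gen hJ.supp_subset hg ht,
        hcons, hfaith⟩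
      obtain ⟨u, v, rfl⟩ := hJ.isInterval
      exact ordConnected_Ioo
    refine hw.exists_equiv htJ ?_
    rw [gen, gen, gen, ← Subgroup.closure_union, ← image_union, hABC.eq_union]
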